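/- Let $d>0$ and $T>0$, let $\Omega_{\mathcal O}\subset\mathbb R^2$ be a bounded open set with $0\in\Omega_{\mathcal O}$ (no regularity of its boundary is needed), and let $\Omega:=\mathbb R^2\setminus\overline{\Omega_{\mathcal O}}$ be its exterior. Let $G_t(x):=(4\pi d t)^{-1}e^{-|x|^2/(4dt)}$ for $t>0$, $x\in\mathbb R^2$. Suppose $\hat u_0\in H^1(\mathbb R^2)$ and $\bar\phi\in H^1(0,T)$ are real-valued, and consider the mild solution of $\partial_t\hat u=d\Delta\hat u+\bar\phi\,\delta_0$ on $\mathbb R^2$, $\hat u(0)=\hat u_0$, that is, $$\hat u(x,t)=\int_{\mathbb R^2}G_t(x-y)\,\hat u_0(y)\,dy+\int_0^tG_{t-s}(x)\,\bar\phi(s)\,ds .$$ Then both integrals converge absolutely for all $x\in\Omega$ and $0<t\le T$, $\hat u(\cdot,t)|_\Omega\in L^2(\Omega)$ for all $0<t\le T$, and the restriction of $\hat u$ to $\Omega$ satisfies $$\hat u\in H^1(0,T;L^2(\Omega))\cap L^2(0,T;H^2(\Omega)).$$ Moreover $\partial_t\hat u(t)=d\,\Delta\hat u(t)$ in $L^2(\Omega)$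 for almost every $t\in(0,T)$, where $\partial_t$ is the weak time derivative of the $L^2(\Omega)$-valued function $\hat u$ and $\Delta$ is taken in the weak sense on $\Omega$. -/

import Mathlib

open MeasureTheory Set
open scoped ENNReal ContDiff

noncomputable section

/-- The plane `ℝ²` with its Euclidean norm. -/
abbrev Plane : Type := EuclideanSpace ℝ (Fin 2)

/-- The `i`-th standard unit vector of the plane. -/
def unitVec (i : Fin 2) : Plane := EuclideanSpace.single i 1

/-- `g` is the weak derivative of `f` in the direction `v` on the open set `U`:
`∫_U (∂_v ψ) f = - ∫_U ψ g` for every test function `ψ ∈ C_c^∞(U; ℝ)`.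
It is only used for functions `f`, `g` that are square integrable on `U`. With `E = ℝ`, `v = 1`
and a Banach space `F` this is the weak time derivative of an `F`-valued function. -/
def IsWeakDeriv {E F : Type*} [NormedAddCommGroup E] [NormedSpace ℝ E] [MeasureSpace E]
    [NormedAddCommGroup F] [NormedSpace ℝ F] [CompleteSpace F]
    (U : Set E) (v : E) (f g : E → F) : Prop :=
  ∀ ψ : E → ℝ, ContDiff ℝ ∞ ψ → HasCompactSupport ψ → tsupport ψ ⊆ U →
    ∫ x in U, (fderiv ℝ ψ x v) • f x = - ∫ x in U, ψ x • g x

/-- `f ∈ H¹(U; F)`: `f` is in `L²(U; F)` and has weak derivatives in `L²(U; F)` in all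
directions. -/
def MemH1 {E F : Type*} [NormedAddCommGroup E] [NormedSpace ℝ E] [MeasureSpace E]
    [NormedAddCommGroup F] [NormedSpace ℝ F] [CompleteSpace F]
    (U : Set E) (f : E → F) : Prop :=
  MemLp f 2 (volume.restrict U) ∧
    ∀ v : E, ∃ g : E → F, MemLp g 2 (volume.restrict U) ∧ IsWeakDeriv U v f g

/-- The real Hilbert space `L²(U)` for a subset `U` of the plane. -/
abbrev L2Space (U : Set Plane) : Type := Lp ℝ 2 (volume.restrict U : Measure Plane)

/-- Index set of the partial derivatives of order at most two: the function itself, its first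
derivatives `∂_i`, and its second derivatives `∂_j ∂_i` (index `(i, j)`). -/
abbrev JetIndex : Type := Unit ⊕ (Fin 2 ⊕ (Fin 2 × Fin 2))

/-- Families `(w, w_i, w_ij)` of functions in `L²(U)`, with the Hilbert norm
`‖w‖² + ∑ ‖w_i‖² + ∑ ‖w_ij‖²`. -/
abbrev JetSpace (U : Set Plane) : Type := PiLp 2 (fun _ : JetIndex => L2Space U)

theorem integrable_test_smul {U : Set Plane} {χ : Plane → ℝ} (hc : Continuous χ)
    (hs : HasCompactSupport χ) (f : L2Space U) :
    Integrable (fun x => χ x • f x) (volume.restrict U) := by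
  have h1 : MemLp χ 2 (volume.restrict U) := hc.memLp_of_hasCompactSupport hs
  have h2 : MemLp f 2 (volume.restrict U) := Lp.memLp f
  exact h1.integrable_mul h2

theorem integrable_dtest_smul {U : Set Plane} {ψ : Plane → ℝ} (hψ : ContDiff ℝ ∞ ψ)
    (hs : HasCompactSupport ψ) (v : Plane) (f : L2Space U) :
    Integrable (fun x => (fderiv ℝ ψ x v) • f x) (volume.restrict U) :=
  integrable_test_smul ((hψ.continuous_fderiv (by simp)).clm_apply continuous_const)
    (hs.fderiv_apply (𝕜 := ℝ) v) f

theorem IsWeakDeriv.add_L2 {U : Set Plane} {v : Plane} {f g f' g' : L2Space U}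
    (h : IsWeakDeriv U v f g) (h' : IsWeakDeriv U v f' g') :
    IsWeakDeriv U v (f + f' : L2Space U) (g + g' : L2Space U) := by
  intro ψ hψ hs hU
  have e1 : ∫ x in U, (fderiv ℝ ψ x v) • (f + f' : L2Space U) x =
      ∫ x in U, ((fderiv ℝ ψ x v) • f x + (fderiv ℝ ψ x v) • f' x) := by
    apply integral_congr_ae
    filter_upwards [Lp.coeFn_add f f'] with x hx
    rw [hx, Pi.add_apply, smul_add]
  have e2 : ∫ x in U, ψ x • (g + g' : L2Space U) x =
      ∫ x in U, (ψ x • g x + ψ x • g' x) := by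
    apply integral_congr_ae
    filter_upwards [Lp.coeFn_add g g'] with x hx
    rw [hx, Pi.add_apply, smul_add]
  rw [e1, e2, integral_add (integrable_dtest_smul hψ hs v f) (integrable_dtest_smul hψ hs v f'),
    integral_add (integrable_test_smul hψ.continuous hs g)
      (integrable_test_smul hψ.continuous hs g'), h ψ hψ hs hU, h' ψ hψ hs hU, neg_add]

theorem IsWeakDeriv.smul_L2 {U : Set Plane} {v : Plane} {f g : L2Space U} (c : ℝ)
    (h : IsWeakDeriv U v f g) :
    IsWeakDeriv U v (c • f : L2Space U) (c • g : L2Space U) := by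
  intro ψ hψ hs hU
  have e1 : ∫ x in U, (fderiv ℝ ψ x v) • (c • f : L2Space U) x =
      ∫ x in U, c • ((fderiv ℝ ψ x v) • f x) := by
    apply integral_congr_ae
    filter_upwards [Lp.coeFn_smul c f] with x hx
    rw [hx, Pi.smul_apply, smul_comm]
  have e2 : ∫ x in U, ψ x • (c • g : L2Space U) x = ∫ x in U, c • (ψ x • g x) := by
    apply integral_congr_ae
    filter_upwards [Lp.coeFn_smul c g] with x hx
    rw [hx, Pi.smul_apply, smul_comm]
  rw [e1, e2, integral_smul, integral_smul, h ψ hψ hs hU, smul_neg]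

theorem IsWeakDeriv.zero_L2 {U : Set Plane} {v : Plane} :
    IsWeakDeriv U v (0 : L2Space U) (0 : L2Space U) := by
  intro ψ hψ hs hU
  have e1 : ∫ x in U, (fderiv ℝ ψ x v) • (0 : L2Space U) x = 0 := by
    apply integral_eq_zero_of_ae
    filter_upwards [Lp.coeFn_zero ℝ 2 (volume.restrict U : Measure Plane)] with x hx
    change _ • _ = (0 : ℝ)
    rw [hx, Pi.zero_apply, smul_zero]
  have e2 : ∫ x in U, ψ x • (0 : L2Space U) x = 0 := by
    apply integral_eq_zero_of_ae
    filter_upwards [Lp.coeFn_zero ℝ 2 (volume.restrict U : Measure Plane)] with x hx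
    change _ • _ = (0 : ℝ)
    rw [hx, Pi.zero_apply, smul_zero]
  rw [e1, e2, neg_zero]

/-- The Sobolev space `H²(U)`: a function `w ∈ L²(U)` together with its weak first derivatives
`∂_i w ∈ L²(U)` and weak second derivatives `∂_j ∂_i w ∈ L²(U)` (which `w` determines). It carries
the usual norm, `‖w‖² + ∑ ‖∂_i w‖² + ∑ ‖∂_j ∂_i w‖²` being its square. -/
def H2Space (U : Set Plane) : Submodule ℝ (JetSpace U) where
  carrier := {w | (∀ i : Fin 2, IsWeakDeriv U (unitVec i) (w (Sum.inl ())) (w (Sum.inr (Sum.inl i)))) ∧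
    ∀ i j : Fin 2, IsWeakDeriv U (unitVec j) (w (Sum.inr (Sum.inl i)))
      (w (Sum.inr (Sum.inr (i, j))))}
  add_mem' := fun ha hb =>
    ⟨fun i => (ha.1 i).add_L2 (hb.1 i), fun i j => (ha.2 i j).add_L2 (hb.2 i j)⟩
  zero_mem' := ⟨fun _ => IsWeakDeriv.zero_L2, fun _ _ => IsWeakDeriv.zero_L2⟩
  smul_mem' := fun c _ ha => ⟨fun i => (ha.1 i).smul_L2 c, fun i j => (ha.2 i j).smul_L2 c⟩

/-- The inclusion `H²(U) → L²(U)`. -/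
def H2Space.toL2 {U : Set Plane} (w : H2Space U) : L2Space U := w.1 (Sum.inl ())

/-- The Laplacian `Δ = ∂₁∂₁ + ∂₂∂₂ : H²(U) → L²(U)`. -/
def H2Space.laplacian {U : Set Plane} (w : H2Space U) : L2Space U :=
  ∑ i : Fin 2, w.1 (Sum.inr (Sum.inr (i, i)))

/-- The heat kernel `G_t(x) = (4 π d t)⁻¹ exp(-|x|² / (4 d t))` of the plane, `t > 0`. -/
def heatKernel (d t : ℝ) (x : Plane) : ℝ :=
  (4 * Real.pi * d * t)⁻¹ * Real.exp (-‖x‖ ^ 2 / (4 * d * t))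

/-- The mild solution, at time `t > 0` and at the point `x`, of `∂_t u = d Δ u + φ δ₀`,
`u(0) = u₀` on the plane:
`û(x, t) = ∫ G_t(x - y) u₀(y) dy + ∫_0^t G_{t-s}(x) φ(s) ds`. -/
def mildSolution (d : ℝ) (u₀ : Plane → ℝ) (φ : ℝ → ℝ) (t : ℝ) (x : Plane) : ℝ :=
  (∫ y, heatKernel d t (x - y) * u₀ y) + ∫ s in (0 : ℝ)..t, heatKernel d (t - s) x * φ s

/-- The exterior `ℝ² \ closure O` of a set `O`. -/
def exteriorDomain (O : Set Plane) : Set Plane := (closure O)ᶜ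

end

/-!
The mild solution is `G_t * u₀` plus the Duhamel integral `∫₀ᵗ φ(s) G_{t-s} ds` of the point source,
and each summand is treated as a curve in the Hilbert space `H²(Ω)` of second order jets.

All kernels that occur (the heat kernel and its derivatives) lie in the span of the Gaussian
monomials `t⁻ᵏ x₀ᵃ x₁ᵇ exp(-|x|² / (4 d t))`. This span is closed under time derivatives, and away
from the space-time origin its members are bounded by `C t exp(-c |x|²)` (`gaussKernels_bound`).
Convolution with such kernels acts on `L²(ℝ²)` by Young's inequality, and may be differentiated under
the integral sign. A curve with a pointwise time derivative that is Lipschitz with an `L²` constant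
is differentiable in `L²` (`lpOf_hasDerivAt`), so that both summands are classical `L²(Ω)`-valued
solutions of the heat equation on `(0, T)`; the weak time derivative is then the classical one.

What remains is square integrability in time. For `G_t * u₀` the only singular part is the second
derivatives as `t → 0`. Since `u₀ ∈ H¹(ℝ²)`, one derivative can be moved from the kernel onto `u₀`
(`gconv_weakDeriv`), and the energy identity `d/dt ‖G_t * f‖² = -2d ‖∇(G_t * f)‖²`
(`jetEnergy_hasDerivAt`) bounds `∇(G_t * f)` in `L²((0, T) × ℝ²)` for each `f = ∂ᵢu₀`. For the Duhamel
integral, `Ω` stays away from the source, so `G_t`, extended by zero to `t ≤ 0`, is a continuous curve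
in `H²(Ω)` and a `C¹` curve in `L²(Ω)` on the whole time axis, with derivative `d Δ G_t`
(`kernelCurve_continuous`, `kernelCurve_hasDerivAt`). Hence `∫ φ(s) G_{t-s} ds` is a bounded,
continuous `H²(Ω)`-valued Bochner integral which may be differentiated under the integral sign.
-/

open MeasureTheory Set
open scoped ENNReal ContDiff

noncomputable section

/-! ### Gaussian kernels -/

/-- The Gaussian monomial `t⁻ᵏ x₀ᵃ x₁ᵇ exp(-|x|² / (4 d t))`. -/
def gaussMonomial (d : ℝ) (k a b : ℕ) (t : ℝ) (x : Plane) : ℝ :=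
  t⁻¹ ^ k * (x 0 ^ a * x 1 ^ b) * Real.exp (-‖x‖ ^ 2 / (4 * d * t))

/-- The linear span of the Gaussian monomials, a space of functions of `(t, x)` containing the heat
kernel and closed (for `t > 0`) under derivatives in `t` and in `x`. -/
def gaussKernels (d : ℝ) : Submodule ℝ (ℝ → Plane → ℝ) :=
  Submodule.span ℝ (range fun p : ℕ × ℕ × ℕ => gaussMonomial d p.1 p.2.1 p.2.2)

theorem gaussMonomial_mem (d : ℝ) (k a b : ℕ) : gaussMonomial d k a b ∈ gaussKernels d :=
  Submodule.subset_span ⟨(k, a, b), rfl⟩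

theorem Plane.norm_sq (x : Plane) : ‖x‖ ^ 2 = x 0 ^ 2 + x 1 ^ 2 := by
  simp [EuclideanSpace.norm_sq_eq]

theorem Plane.abs_coord_le (x : Plane) (i : Fin 2) : |x i| ≤ ‖x‖ := by
  simpa using PiLp.norm_apply_le x i

theorem pow_mul_exp_neg_le (n : ℕ) {c s : ℝ} (hc : 0 < c) (hs : 0 ≤ s) :
    s ^ n * Real.exp (-(c * s)) ≤ n.factorial / c ^ n := by
  have h := Real.pow_div_factorial_le_exp (c * s) (by positivity) n
  have hn : (0 : ℝ) < n.factorial := by exact_mod_cast n.factorial_pos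
  rw [div_le_iff₀ hn, mul_pow] at h
  rw [Real.exp_neg, le_div_iff₀ (by positivity), mul_right_comm, ← div_eq_mul_inv,
    div_le_iff₀ (Real.exp_pos _)]
  linarith

/-- Away from the space-time origin a Gaussian monomial is bounded, uniformly on bounded time
intervals, by a fixed Gaussian in `x`; the extra factor `t` records that it vanishes as `t → 0`
away from `x = 0`. -/
theorem gaussMonomial_bound {d T ρ : ℝ} (hd : 0 < d) (hT : 0 < T) (hρ : 0 < ρ) (k a b : ℕ) :
    ∃ C, 0 ≤ C ∧ ∀ t, 0 < t → t ≤ T → ∀ x : Plane, (ρ ≤ t ∨ ρ ≤ ‖x‖ ^ 2) →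
      |gaussMonomial d k a b t x| ≤ C * t * Real.exp (-((8 * d * T)⁻¹ * ‖x‖ ^ 2)) := by
  -- A quarter of the exponent absorbs the power of `t`, a quarter the power of `x`, and the
  -- remaining half is the asserted Gaussian.
  set m := a + b
  set c := (16 * d * T)⁻¹ with hc
  have hc0 : 0 < c := by positivity
  set e := ρ * (16 * d)⁻¹ with he
  have he0 : 0 < e := by positivity
  set C1 : ℝ := 1 + m.factorial / c ^ m
  set C2 : ℝ := ρ⁻¹ ^ (k + 1) + (k + 1).factorial / e ^ (k + 1)
  refine ⟨C2 * C1, by positivity, fun t ht htT x hx => ?_⟩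
  set r := ‖x‖
  have hr : 0 ≤ r := norm_nonneg x
  have ht' : T⁻¹ ≤ t⁻¹ := inv_anti₀ ht htT
  have hE : Real.exp (-r ^ 2 / (4 * d * t)) = Real.exp (-(r ^ 2 * (16 * d)⁻¹ * t⁻¹)) *
      Real.exp (-((16 * d)⁻¹ * t⁻¹ * r ^ 2)) * Real.exp (-((8 * d)⁻¹ * t⁻¹ * r ^ 2)) := by
    rw [← Real.exp_add, ← Real.exp_add]
    congr 1
    field_simp
    ring
  have h1 : r ^ m * Real.exp (-((16 * d)⁻¹ * t⁻¹ * r ^ 2)) ≤ C1 := by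
    have h2 : Real.exp (-((16 * d)⁻¹ * t⁻¹ * r ^ 2)) ≤ Real.exp (-(c * r ^ 2)) := by
      apply Real.exp_le_exp.2
      rw [hc, mul_inv (16 * d) T]
      gcongr
    -- Only even powers of `r` are compared with the Gaussian.
    have h3 : r ^ m ≤ 1 + (r ^ 2) ^ m := by
      rw [← pow_mul, mul_comm 2 m, pow_mul]
      nlinarith [sq_nonneg (r ^ m - 1), sq_nonneg (r ^ m)]
    calc _ ≤ (1 + (r ^ 2) ^ m) * Real.exp (-(c * r ^ 2)) := by gcongr
      _ = Real.exp (-(c * r ^ 2)) + (r ^ 2) ^ m * Real.exp (-(c * r ^ 2)) := by ring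
      _ ≤ C1 := add_le_add (Real.exp_le_one_iff.2 (by
          have : 0 ≤ c * r ^ 2 := by positivity
          linarith)) (pow_mul_exp_neg_le m hc0 (by positivity))
  have h2 : t⁻¹ ^ (k + 1) * Real.exp (-(r ^ 2 * (16 * d)⁻¹ * t⁻¹)) ≤ C2 := by
    rcases hx with hx | hx
    · calc _ ≤ ρ⁻¹ ^ (k + 1) * 1 := by
            gcongr
            exact Real.exp_le_one_iff.2 (by
              have : 0 ≤ r ^ 2 * (16 * d)⁻¹ * t⁻¹ := by positivity
              linarith)
        _ ≤ C2 := by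
            rw [mul_one]
            exact le_add_of_nonneg_right (by positivity)
    · calc _ ≤ t⁻¹ ^ (k + 1) * Real.exp (-(e * t⁻¹)) := by
            rw [he]
            gcongr
        _ ≤ _ := pow_mul_exp_neg_le (k + 1) he0 (by positivity)
        _ ≤ C2 := le_add_of_nonneg_left (by positivity)
  have h3 : Real.exp (-((8 * d)⁻¹ * t⁻¹ * r ^ 2)) ≤ Real.exp (-((8 * d * T)⁻¹ * r ^ 2)) := by
    apply Real.exp_le_exp.2
    rw [mul_inv (8 * d) T]
    gcongr
  have h4 : |x 0 ^ a * x 1 ^ b| ≤ r ^ m := by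
    rw [abs_mul, abs_pow, abs_pow, pow_add]
    gcongr <;> exact Plane.abs_coord_le x _
  have h5 : t⁻¹ ^ k = t⁻¹ ^ (k + 1) * t := by
    rw [pow_succ, mul_assoc, inv_mul_cancel₀ ht.ne', mul_one]
  unfold gaussMonomial
  rw [abs_mul, abs_mul, Real.abs_exp, abs_of_nonneg (by positivity : 0 ≤ t⁻¹ ^ k)]
  calc _ ≤ t⁻¹ ^ k * r ^ m * Real.exp (-r ^ 2 / (4 * d * t)) := by gcongr
    _ = (t⁻¹ ^ (k + 1) * Real.exp (-(r ^ 2 * (16 * d)⁻¹ * t⁻¹))) *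
        (r ^ m * Real.exp (-((16 * d)⁻¹ * t⁻¹ * r ^ 2))) * t *
          Real.exp (-((8 * d)⁻¹ * t⁻¹ * r ^ 2)) := by rw [h5, hE]; ring
    _ ≤ C2 * C1 * t * Real.exp (-((8 * d * T)⁻¹ * r ^ 2)) := by gcongr

theorem gaussKernels_bound {d T ρ : ℝ} (hd : 0 < d) (hT : 0 < T) (hρ : 0 < ρ)
    {K : ℝ → Plane → ℝ} (hK : K ∈ gaussKernels d) :
    ∃ C, 0 ≤ C ∧ ∀ t, 0 < t → t ≤ T → ∀ x : Plane, (ρ ≤ t ∨ ρ ≤ ‖x‖ ^ 2) →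
      |K t x| ≤ C * t * Real.exp (-((8 * d * T)⁻¹ * ‖x‖ ^ 2)) := by
  induction hK using Submodule.span_induction with
  | mem K hK =>
    obtain ⟨p, rfl⟩ := hK
    exact gaussMonomial_bound hd hT hρ _ _ _
  | zero => exact ⟨0, le_rfl, by simp⟩
  | add K L _ _ hK hL =>
    obtain ⟨C, hC, h⟩ := hK
    obtain ⟨D, hD, h'⟩ := hL
    refine ⟨C + D, by positivity, fun t ht htT x hx => ?_⟩
    calc _ ≤ |K t x| + |L t x| := abs_add_le _ _
      _ ≤ _ := add_le_add (h t ht htT x hx) (h' t ht htT x hx)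
      _ = _ := by ring
  | smul c K _ hK =>
    obtain ⟨C, hC, h⟩ := hK
    refine ⟨|c| * C, by positivity, fun t ht htT x hx => ?_⟩
    calc _ = |c| * |K t x| := abs_mul _ _
      _ ≤ |c| * _ := mul_le_mul_of_nonneg_left (h t ht htT x hx) (abs_nonneg c)
      _ = _ := by ring

theorem gaussKernels_contDiff {d : ℝ} {K : ℝ → Plane → ℝ} (hK : K ∈ gaussKernels d) (t : ℝ) :
    ContDiff ℝ ∞ (K t) := by
  induction hK using Submodule.span_induction with
  | mem K hK =>
    obtain ⟨p, rfl⟩ := hK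
    have h (i : Fin 2) : ContDiff ℝ ∞ fun x : Plane => x i := by fun_prop
    exact (contDiff_const.mul (((h 0).pow _).mul ((h 1).pow _))).mul
      (((contDiff_norm_sq ℝ).neg.div_const _).exp)
  | zero => exact contDiff_const
  | add K L _ _ hK hL => exact hK.add hL
  | smul c K _ hK => exact hK.const_smul c

theorem gaussKernels_hasDerivAt {d : ℝ} (hd : 0 < d) {K : ℝ → Plane → ℝ}
    (hK : K ∈ gaussKernels d) :
    ∃ K' ∈ gaussKernels d, ∀ t, 0 < t → ∀ x, HasDerivAt (fun t => K t x) (K' t x) t := by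
  induction hK using Submodule.span_induction with
  | mem K hK =>
    obtain ⟨⟨k, a, b⟩, rfl⟩ := hK
    refine ⟨(-k : ℝ) • gaussMonomial d (k + 1) a b + (4 * d)⁻¹ •
      (gaussMonomial d (k + 2) (a + 2) b + gaussMonomial d (k + 2) a (b + 2)),
      add_mem (Submodule.smul_mem _ _ (gaussMonomial_mem _ _ _ _)) (Submodule.smul_mem _ _
        (add_mem (gaussMonomial_mem _ _ _ _) (gaussMonomial_mem _ _ _ _))), fun t ht x => ?_⟩
    have h1 : HasDerivAt (fun t : ℝ => t⁻¹ ^ k) (-k * t⁻¹ ^ (k + 1)) t := by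
      refine ((hasDerivAt_inv ht.ne').pow k).congr_deriv ?_
      rcases k with _ | k
      · simp
      · rw [Nat.add_sub_cancel, ← inv_pow]
        ring
    have h2 : HasDerivAt (fun t : ℝ => -‖x‖ ^ 2 / (4 * d * t))
        ((4 * d)⁻¹ * ‖x‖ ^ 2 * t⁻¹ ^ 2) t := by
      have := (hasDerivAt_inv ht.ne').const_mul (-‖x‖ ^ 2 / (4 * d))
      refine (this.congr_of_eventuallyEq (.of_forall fun s => ?_)).congr_deriv ?_
      · change -‖x‖ ^ 2 / (4 * d * s) = -‖x‖ ^ 2 / (4 * d) * s⁻¹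
        rw [← div_div, div_eq_mul_inv _ s]
      · field_simp
    refine ((h1.mul_const (x 0 ^ a * x 1 ^ b)).mul h2.exp).congr_deriv ?_
    simp only [Pi.add_apply, Pi.smul_apply, smul_eq_mul, gaussMonomial, Plane.norm_sq]
    ring
  | zero => exact ⟨0, zero_mem _, fun t _ x => hasDerivAt_const _ _⟩
  | add K L _ _ hK hL =>
    obtain ⟨K', hK', h⟩ := hK
    obtain ⟨L', hL', h'⟩ := hL
    exact ⟨K' + L', add_mem hK' hL', fun t ht x => (h t ht x).add (h' t ht x)⟩
  | smul c K _ hK =>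
    obtain ⟨K', hK', h⟩ := hK
    exact ⟨c • K', Submodule.smul_mem _ _ hK', fun t ht x => (h t ht x).const_smul c⟩

/-- The heat kernel and its derivatives of order at most two in `x`. -/
def jetKernel (d : ℝ) : JetIndex → ℝ → Plane → ℝ
  | Sum.inl _ => heatKernel d
  | Sum.inr (Sum.inl i) => fun t x => -(x i / (2 * d * t)) * heatKernel d t x
  | Sum.inr (Sum.inr (i, j)) => fun t x =>
      (x i * x j / (2 * d * t) ^ 2 - (if i = j then 1 else 0) / (2 * d * t)) * heatKernel d t x

theorem heatKernel_eq (d : ℝ) : heatKernel d = (4 * Real.pi * d)⁻¹ • gaussMonomial d 1 0 0 := by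
  ext t x
  simp only [heatKernel, gaussMonomial, Pi.smul_apply, smul_eq_mul]
  rw [mul_inv _ t]
  ring

theorem jetKernel_mem (d : ℝ) (κ : JetIndex) : jetKernel d κ ∈ gaussKernels d := by
  have h1 (i : Fin 2) (a b : ℕ) (h : ∀ x : Plane, x i = x 0 ^ a * x 1 ^ b) :
      jetKernel d (Sum.inr (Sum.inl i)) =
        (-(2 * d)⁻¹ * (4 * Real.pi * d)⁻¹) • gaussMonomial d 2 a b := by
    ext t x
    simp only [heatKernel, jetKernel, gaussMonomial, Pi.smul_apply, smul_eq_mul, ← h, mul_inv,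
      div_eq_mul_inv]
    ring
  have h2 (i j : Fin 2) (a b : ℕ) (h : ∀ x : Plane, x i * x j = x 0 ^ a * x 1 ^ b) :
      jetKernel d (Sum.inr (Sum.inr (i, j))) =
        ((2 * d)⁻¹ ^ 2 * (4 * Real.pi * d)⁻¹) • gaussMonomial d 3 a b -
        ((if i = j then 1 else 0) * (2 * d)⁻¹ * (4 * Real.pi * d)⁻¹) •
          gaussMonomial d 2 0 0 := by
    ext t x
    simp only [heatKernel, jetKernel, gaussMonomial, Pi.smul_apply, smul_eq_mul, Pi.sub_apply, ← h,
      mul_inv, div_eq_mul_inv, mul_pow, inv_pow]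
    ring
  have hs (c : ℝ) (k a b : ℕ) : c • gaussMonomial d k a b ∈ gaussKernels d :=
    Submodule.smul_mem _ _ (gaussMonomial_mem _ _ _ _)
  match κ with
  | Sum.inl _ =>
    change heatKernel d ∈ _
    exact heatKernel_eq d ▸ hs _ _ _ _
  | Sum.inr (Sum.inl 0) => exact h1 0 1 0 (by simp) ▸ hs _ _ _ _
  | Sum.inr (Sum.inl 1) => exact h1 1 0 1 (by simp) ▸ hs _ _ _ _
  | Sum.inr (Sum.inr (0, 0)) => exact h2 0 0 2 0 (fun x => by ring) ▸ sub_mem (hs _ _ _ _) (hs _ _ _ _)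
  | Sum.inr (Sum.inr (0, 1)) => exact h2 0 1 1 1 (fun x => by ring) ▸ sub_mem (hs _ _ _ _) (hs _ _ _ _)
  | Sum.inr (Sum.inr (1, 0)) => exact h2 1 0 1 1 (fun x => by ring) ▸ sub_mem (hs _ _ _ _) (hs _ _ _ _)
  | Sum.inr (Sum.inr (1, 1)) => exact h2 1 1 0 2 (fun x => by ring) ▸ sub_mem (hs _ _ _ _) (hs _ _ _ _)

theorem hasDerivAt_coord_line (x v : Plane) (i : Fin 2) :
    HasDerivAt (fun s : ℝ => (x + s • v) i) (v i) 0 := by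
  have : HasDerivAt (fun s : ℝ => x i + s * v i) (1 * v i) 0 :=
    ((hasDerivAt_id (0 : ℝ)).mul_const (v i)).const_add (x i)
  simpa using this

theorem heatKernel_hasLineDerivAt {d t : ℝ} (hd : 0 < d) (ht : 0 < t) (x : Plane) (i : Fin 2) :
    HasLineDerivAt ℝ (heatKernel d t) (jetKernel d (Sum.inr (Sum.inl i)) t x) x (unitVec i) := by
  have h0 := hasDerivAt_coord_line x (unitVec i) 0
  have h1 := hasDerivAt_coord_line x (unitVec i) 1
  have h := (((((h0.pow 2).add (h1.pow 2)).neg.div_const (4 * d * t)).exp).const_mul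
    (4 * Real.pi * d * t)⁻¹)
  refine (h.congr_of_eventuallyEq (.of_forall fun s => ?_)).congr_deriv ?_
  · simp only [heatKernel, Plane.norm_sq]
    rfl
  · fin_cases i <;> simp [jetKernel, heatKernel, Plane.norm_sq, unitVec] <;> field_simp <;> ring

theorem jetKernel_hasLineDerivAt {d t : ℝ} (hd : 0 < d) (ht : 0 < t) (x : Plane) (i j : Fin 2) :
    HasLineDerivAt ℝ (jetKernel d (Sum.inr (Sum.inl i)) t)
      (jetKernel d (Sum.inr (Sum.inr (i, j))) t x) x (unitVec j) := by
  have h0 := hasDerivAt_coord_line x (unitVec j) i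
  have hG : HasDerivAt (fun s : ℝ => heatKernel d t (x + s • unitVec j))
    (jetKernel d (Sum.inr (Sum.inl j)) t x) 0 := heatKernel_hasLineDerivAt hd ht x j
  have h1 := (h0.div_const (2 * d * t)).neg.mul hG
  refine (h1.congr_of_eventuallyEq (.of_forall fun s => ?_)).congr_deriv ?_
  · rfl
  · simp only [Pi.neg_apply, zero_smul, add_zero, jetKernel, unitVec]
    have : (EuclideanSpace.single j (1 : ℝ) : Plane) i = if i = j then 1 else 0 := by
      simp
    rw [this]
    field_simp
    ring

/-- The heat equation `∂_t G = d Δ G`. -/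
theorem heatKernel_hasDerivAt {d t : ℝ} (hd : 0 < d) (ht : 0 < t) (x : Plane) :
    HasDerivAt (fun t => heatKernel d t x)
      (d * ∑ i : Fin 2, jetKernel d (Sum.inr (Sum.inr (i, i))) t x) t := by
  have h1 : HasDerivAt (fun t : ℝ => (4 * Real.pi * d * t)⁻¹)
      (-(4 * Real.pi * d)⁻¹ * (t ^ 2)⁻¹) t := by
    have := (hasDerivAt_inv ht.ne').const_mul (4 * Real.pi * d)⁻¹
    refine (this.congr_of_eventuallyEq (.of_forall fun s => ?_)).congr_deriv (by ring)
    exact mul_inv _ _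
  have h2 : HasDerivAt (fun t : ℝ => -‖x‖ ^ 2 / (4 * d * t))
      (‖x‖ ^ 2 / (4 * d) * (t ^ 2)⁻¹) t := by
    have := (hasDerivAt_inv ht.ne').const_mul (-‖x‖ ^ 2 / (4 * d))
    refine (this.congr_of_eventuallyEq (.of_forall fun s => ?_)).congr_deriv (by ring)
    change -‖x‖ ^ 2 / (4 * d * s) = -‖x‖ ^ 2 / (4 * d) * s⁻¹
    rw [← div_div, div_eq_mul_inv _ s]
  refine (h1.mul h2.exp).congr_deriv ?_
  simp only [Fin.sum_univ_two, jetKernel, heatKernel, if_true]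
  rw [Plane.norm_sq]
  field_simp
  ring

/-! ### Convolution with Gaussian kernels -/

/-- The Gaussian `exp(-c |x|²)` used as a majorant. -/
def gaussMajorant (c : ℝ) (x : Plane) : ℝ := Real.exp (-(c * ‖x‖ ^ 2))

theorem gaussMajorant_pos (c : ℝ) (x : Plane) : 0 < gaussMajorant c x := Real.exp_pos _

theorem gaussMajorant_continuous (c : ℝ) : Continuous (gaussMajorant c) := by
  unfold gaussMajorant
  fun_prop

theorem gaussMajorant_integral {c : ℝ} (hc : 0 < c) :
    ∫ x, gaussMajorant c x = Real.pi / c := by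
  have h := GaussianFourier.integral_rexp_neg_mul_sq_norm (V := Plane) hc
  simpa [gaussMajorant] using h

theorem gaussMajorant_integrable {c : ℝ} (hc : 0 < c) : Integrable (gaussMajorant c) := by
  refine Integrable.of_integral_ne_zero ?_
  rw [gaussMajorant_integral hc]
  positivity

theorem gaussMajorant_memLp {c : ℝ} (hc : 0 < c) : MemLp (gaussMajorant c) 2 := by
  rw [memLp_two_iff_integrable_sq (gaussMajorant_continuous c).aestronglyMeasurable]
  refine (gaussMajorant_integrable (c := 2 * c) (by positivity)).congr (.of_forall fun x => ?_)
  simp only [gaussMajorant, ← Real.exp_nat_mul]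
  congr 1
  push_cast
  ring

theorem gaussMajorant_add_le {c : ℝ} (hc : 0 < c) (x z : Plane) :
    gaussMajorant c (x + z) ≤ Real.exp (c * ‖z‖ ^ 2) * gaussMajorant (c / 2) x := by
  unfold gaussMajorant
  rw [← Real.exp_add]
  apply Real.exp_le_exp.2
  have h : ‖x‖ ≤ ‖x + z‖ + ‖z‖ := by simpa using norm_sub_le (x + z) z
  have h2 : ‖x‖ ^ 2 ≤ 2 * ‖x + z‖ ^ 2 + 2 * ‖z‖ ^ 2 := by
    nlinarith [sq_nonneg (‖x + z‖ - ‖z‖), norm_nonneg x]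
  nlinarith

/-- A continuous function on the plane dominated by a Gaussian. -/
def GaussBounded (K : Plane → ℝ) : Prop :=
  Continuous K ∧ ∃ c C : ℝ, 0 < c ∧ ∀ z, |K z| ≤ C * gaussMajorant c z

theorem gaussBounded_gaussMajorant {c : ℝ} (hc : 0 < c) : GaussBounded (gaussMajorant c) :=
  ⟨gaussMajorant_continuous c, c, 1, hc, fun z => by
    rw [one_mul, abs_of_pos (gaussMajorant_pos c z)]⟩

theorem GaussBounded.integrable {K : Plane → ℝ} (hK : GaussBounded K) : Integrable K := by
  obtain ⟨h, c, C, hc, hb⟩ := hK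
  exact ((gaussMajorant_integrable hc).const_mul C).mono' h.aestronglyMeasurable (.of_forall hb)

theorem GaussBounded.memLp {K : Plane → ℝ} (hK : GaussBounded K) : MemLp K 2 := by
  obtain ⟨h, c, C, hc, hb⟩ := hK
  exact ((gaussMajorant_memLp hc).const_mul C).mono' h.aestronglyMeasurable (.of_forall hb)

theorem gaussKernels_bound_Icc {d ε T : ℝ} (hd : 0 < d) (hε : 0 < ε) (hT : ε ≤ T)
    {K : ℝ → Plane → ℝ} (hK : K ∈ gaussKernels d) :
    ∃ C, 0 ≤ C ∧ ∀ t ∈ Icc ε T, ∀ x, |K t x| ≤ C * gaussMajorant (8 * d * T)⁻¹ x := by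
  have hT0 : 0 < T := hε.trans_le hT
  obtain ⟨C, hC, h⟩ := gaussKernels_bound hd hT0 hε hK
  refine ⟨C * T, by positivity, fun t ht x => ?_⟩
  refine (h t (hε.trans_le ht.1) ht.2 x (.inl ht.1)).trans ?_
  unfold gaussMajorant
  gcongr
  exact ht.2

theorem gaussKernels_gaussBounded {d t : ℝ} (hd : 0 < d) (ht : 0 < t)
    {K : ℝ → Plane → ℝ} (hK : K ∈ gaussKernels d) : GaussBounded (K t) := by
  obtain ⟨C, -, h⟩ := gaussKernels_bound_Icc hd ht le_rfl hK
  exact ⟨(gaussKernels_contDiff hK t).continuous, _, C, by positivity, h t ⟨le_rfl, le_rfl⟩⟩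

/-- The convolution `(K * f)(x) = ∫ K(x - y) f(y) dy`. -/
def gconv (K f : Plane → ℝ) (x : Plane) : ℝ := ∫ y, K (x - y) * f y

theorem GaussBounded.integrable_mul {K f : Plane → ℝ} (hK : GaussBounded K) (hf : MemLp f 2)
    (x : Plane) : Integrable (fun y => K (x - y) * f y) := by
  have h : MemLp (fun y => K (x - y)) 2 :=
    hK.memLp.comp_measurePreserving (volume.measurePreserving_sub_left x)
  exact h.integrable_mul hf

theorem gconv_aestronglyMeasurable {K f : Plane → ℝ} (hK : Continuous K)
    (hf : AEStronglyMeasurable f) : AEStronglyMeasurable (gconv K f) := by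
  have h : AEStronglyMeasurable (fun p : Plane × Plane => K (p.1 - p.2) * f p.2)
      (volume.prod volume) :=
    (hK.comp (continuous_fst.sub continuous_snd)).aestronglyMeasurable.mul hf.comp_snd
  exact h.integral_prod_right'

/-- The Cauchy-Schwarz inequality for the measure with density `|k|`. -/
theorem sq_integral_mul_le {α : Type*} [MeasurableSpace α] {μ : Measure α} {k f : α → ℝ}
    (hk : Integrable k μ) (hkf : Integrable (fun y => |k y| * f y ^ 2) μ)
    (hf : AEStronglyMeasurable f μ) :
    (∫ y, k y * f y ∂μ) ^ 2 ≤ (∫ y, |k y| ∂μ) * ∫ y, |k y| * f y ^ 2 ∂μ := by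
  have hs : AEStronglyMeasurable (fun y => √|k y|) μ :=
    Real.continuous_sqrt.comp_aestronglyMeasurable hk.1.norm
  have m1 : MemLp (fun y => √|k y|) (ENNReal.ofReal 2) μ := by
    rw [show ENNReal.ofReal 2 = 2 by simp, memLp_two_iff_integrable_sq hs]
    simpa [Real.sq_sqrt] using hk.norm
  have m2 : MemLp (fun y => √|k y| * |f y|) (ENNReal.ofReal 2) μ := by
    rw [show ENNReal.ofReal 2 = 2 by simp,
      memLp_two_iff_integrable_sq (f := fun y => √|k y| * |f y|) (hs.mul hf.norm)]
    simpa [mul_pow, Real.sq_sqrt] using hkf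
  have h := integral_mul_le_Lp_mul_Lq_of_nonneg (μ := μ) (p := 2) (q := 2)
    Real.HolderConjugate.two_two
    (.of_forall fun y => Real.sqrt_nonneg |k y|)
    (.of_forall fun y => mul_nonneg (Real.sqrt_nonneg |k y|) (abs_nonneg (f y))) m1 m2
  have e1 (y : α) : √|k y| * (√|k y| * |f y|) = |k y * f y| := by
    rw [← mul_assoc, Real.mul_self_sqrt (abs_nonneg _), abs_mul]
  simp only [e1, Real.rpow_two, mul_pow, Real.sq_sqrt (abs_nonneg _), sq_abs,
    ← Real.sqrt_eq_rpow] at h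
  have h0 : |∫ y, k y * f y ∂μ| ≤ ∫ y, |k y * f y| ∂μ := abs_integral_le_integral_abs
  have h1 : 0 ≤ ∫ y, |k y| ∂μ := integral_nonneg fun y => abs_nonneg _
  have h2 : 0 ≤ ∫ y, |k y| * f y ^ 2 ∂μ := integral_nonneg fun y => by positivity
  rw [← Real.sqrt_mul h1] at h
  calc _ = |∫ y, k y * f y ∂μ| ^ 2 := (sq_abs _).symm
    _ ≤ √((∫ y, |k y| ∂μ) * ∫ y, |k y| * f y ^ 2 ∂μ) ^ 2 := by
        gcongr
        exact h0.trans h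
    _ = _ := Real.sq_sqrt (mul_nonneg h1 h2)

/-- Young's inequality `‖K * f‖₂ ≤ ‖K‖₁ ‖f‖₂`, in squared form. -/
theorem GaussBounded.young {K f : Plane → ℝ} (hK : GaussBounded K) (hf : MemLp f 2) :
    MemLp (gconv K f) 2 ∧ ∫ x, gconv K f x ^ 2 ≤ (∫ z, |K z|) ^ 2 * ∫ y, f y ^ 2 := by
  have hf2 : Integrable (fun y => f y ^ 2) := (memLp_two_iff_integrable_sq hf.1).1 hf
  have hp := hf2.convolution_integrand (ContinuousLinearMap.mul ℝ ℝ) hK.integrable.norm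
  have hi : Integrable (fun x => ∫ y, |K (x - y)| * f y ^ 2) := by
    refine hp.integral_prod_left.congr (.of_forall fun x => ?_)
    simp [mul_comm]
  have he : ∫ x, ∫ y, |K (x - y)| * f y ^ 2 = (∫ z, |K z|) * ∫ y, f y ^ 2 := by
    have := integral_convolution (L := ContinuousLinearMap.mul ℝ ℝ) hf2 hK.integrable.norm
    simp only [convolution, ContinuousLinearMap.mul_apply', Real.norm_eq_abs] at this
    rw [mul_comm, ← this]
    simp only [mul_comm]
  obtain ⟨hc, c, C, hc0, hb⟩ := id hK
  have hbd (z : Plane) : |K z| ≤ |C| := by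
    refine (hb z).trans ?_
    calc _ ≤ |C| * gaussMajorant c z := by
          have := (gaussMajorant_pos c z).le
          gcongr
          exact le_abs_self C
      _ ≤ |C| * 1 := by
          gcongr
          exact Real.exp_le_one_iff.2 (by have : 0 ≤ c * ‖z‖ ^ 2 := by positivity
                                          linarith)
      _ = |C| := mul_one _
  have hle (x : Plane) :
      gconv K f x ^ 2 ≤ (∫ z, |K z|) * ∫ y, |K (x - y)| * f y ^ 2 := by
    have hk : Integrable (fun y => K (x - y)) :=
      (volume.measurePreserving_sub_left x).integrable_comp_of_integrable hK.integrable
    have := sq_integral_mul_le hk (hf2.bdd_mul (c := |C|) hk.1.norm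
      (.of_forall fun y => by simpa using hbd (x - y))) hf.1
    rwa [integral_sub_left_eq_self (fun z => |K z|) volume x] at this
  have hm : AEStronglyMeasurable (gconv K f) := gconv_aestronglyMeasurable hc hf.1
  have hint : Integrable (fun x => gconv K f x ^ 2) :=
    (hi.const_mul (∫ z, |K z|)).mono' (hm.pow 2) (.of_forall fun x => by
      rw [Real.norm_eq_abs, abs_of_nonneg (sq_nonneg _)]
      exact hle x)
  refine ⟨(memLp_two_iff_integrable_sq hm).2 hint, ?_⟩
  calc _ ≤ ∫ x, (∫ z, |K z|) * ∫ y, |K (x - y)| * f y ^ 2 :=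
        integral_mono hint (hi.const_mul _) hle
    _ = _ := by rw [integral_const_mul, he]; ring

theorem abs_gconv_le {K f : Plane → ℝ} {C c : ℝ} (hc : 0 < c)
    (hb : ∀ z, |K z| ≤ C * gaussMajorant c z) (hf : MemLp f 2) (x : Plane) :
    |gconv K f x| ≤ C * gconv (gaussMajorant c) (fun y => |f y|) x := by
  unfold gconv
  rw [← integral_const_mul]
  refine norm_integral_le_of_norm_le (f := fun y => K (x - y) * f y)
    (((gaussBounded_gaussMajorant hc).integrable_mul hf.norm x).const_mul C)
    (.of_forall fun y => ?_)
  rw [norm_mul, Real.norm_eq_abs, Real.norm_eq_abs, ← mul_assoc]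
  gcongr
  exact hb _

theorem gconv_hasDerivAt {d : ℝ} (hd : 0 < d) {K K' : ℝ → Plane → ℝ} (hK : K ∈ gaussKernels d)
    (hK' : K' ∈ gaussKernels d)
    (h : ∀ t, 0 < t → ∀ x, HasDerivAt (fun t => K t x) (K' t x) t) {f : Plane → ℝ}
    (hf : MemLp f 2) {t : ℝ} (ht : 0 < t) (x : Plane) :
    HasDerivAt (fun t => gconv (K t) f x) (gconv (K' t) f x) t := by
  obtain ⟨C, hC, hb⟩ := gaussKernels_bound_Icc (ε := t / 2) (T := 2 * t) hd (by positivity)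
    (by linarith) hK'
  have hpos : ∀ s ∈ Icc (t / 2) (2 * t), 0 < s := fun s hs => lt_of_lt_of_le (by positivity) hs.1
  refine (hasDerivAt_integral_of_dominated_loc_of_deriv_le
    (F := fun t y => K t (x - y) * f y) (F' := fun t y => K' t (x - y) * f y)
    (bound := fun y => C * (gaussMajorant (8 * d * (2 * t))⁻¹ (x - y) * |f y|))
    (s := Icc (t / 2) (2 * t)) (Icc_mem_nhds (by linarith) (by linarith)) ?_ ?_ ?_ ?_ ?_ ?_).2
  · filter_upwards [Ioi_mem_nhds ht] with s hs
    exact ((gaussKernels_gaussBounded hd hs hK).integrable_mul hf x).1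
  · exact (gaussKernels_gaussBounded hd ht hK).integrable_mul hf x
  · exact ((gaussKernels_gaussBounded hd ht hK').integrable_mul hf x).1
  · refine .of_forall fun y s hs => ?_
    rw [norm_mul, Real.norm_eq_abs, Real.norm_eq_abs, ← mul_assoc]
    gcongr
    exact hb s hs _
  · exact ((gaussBounded_gaussMajorant (by positivity)).integrable_mul hf.norm x).const_mul C
  · exact .of_forall fun y s hs => (h s (hpos s hs) (x - y)).mul_const (f y)

theorem gconv_hasLineDerivAt {K K' f : Plane → ℝ} {v : Plane} (hK : GaussBounded K)
    (hK' : GaussBounded K') (h : ∀ x, HasLineDerivAt ℝ K (K' x) x v) (hf : MemLp f 2)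
    (x : Plane) : HasLineDerivAt ℝ (gconv K f) (gconv K' f x) x v := by
  obtain ⟨-, c, C, hc, hb⟩ := id hK'
  have hC : 0 ≤ C := by
    have := (abs_nonneg _).trans (hb 0)
    exact nonneg_of_mul_nonneg_left this (gaussMajorant_pos c 0)
  have key : HasDerivAt (fun s : ℝ => ∫ y, K (x + s • v - y) * f y)
      (∫ y, K' (x + (0 : ℝ) • v - y) * f y) 0 := by
    refine (hasDerivAt_integral_of_dominated_loc_of_deriv_le
      (F := fun (s : ℝ) y => K (x + s • v - y) * f y)
      (F' := fun (s : ℝ) y => K' (x + s • v - y) * f y)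
      (bound := fun y => C * Real.exp (c * ‖v‖ ^ 2) * (gaussMajorant (c / 2) (x - y) * |f y|))
      (s := Icc (-1) 1) (Icc_mem_nhds (by norm_num) (by norm_num)) ?_ ?_ ?_ ?_ ?_ ?_).2
    · exact .of_forall fun s => (hK.integrable_mul hf _).1
    · exact hK.integrable_mul hf _
    · exact (hK'.integrable_mul hf _).1
    · refine .of_forall fun y s hs => ?_
      rw [norm_mul, Real.norm_eq_abs, Real.norm_eq_abs, ← mul_assoc]
      gcongr
      refine (hb _).trans ?_
      rw [mul_assoc]
      gcongr
      rw [add_sub_right_comm]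
      refine (gaussMajorant_add_le hc _ _).trans ?_
      have hs1 : |s| ≤ 1 := abs_le.2 hs
      have := gaussMajorant_pos (c / 2) (x - y)
      gcongr
      rw [norm_smul]
      exact mul_le_of_le_one_left (norm_nonneg v) hs1
    · exact ((gaussBounded_gaussMajorant (by positivity)).integrable_mul hf.norm x).const_mul _
    · refine .of_forall fun y s _ => HasDerivAt.mul_const ?_ (f y)
      have h1 : HasDerivAt (fun r : ℝ => K (x + s • v - y + r • v)) (K' (x + s • v - y)) (s - s) := by
        rw [sub_self]
        exact h (x + s • v - y)
      refine (h1.comp_sub_const s s).congr_of_eventuallyEq (.of_forall fun r => ?_)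
      change K _ = K _
      congr 1
      module
  rw [zero_smul, add_zero] at key
  exact key

/-! ### Weak derivatives against non-compactly supported test functions -/

/-- Smooth cutoff functions `χ(x / (n + 1))` on the plane, with gradients of size `O(1 / n)`. -/
theorem exists_cutoff : ∃ χ : ℕ → Plane → ℝ, (∀ n, ContDiff ℝ ∞ (χ n)) ∧
    (∀ n, HasCompactSupport (χ n)) ∧ (∀ n x, |χ n x| ≤ 1) ∧
    (∀ x, Filter.Tendsto (fun n => χ n x) Filter.atTop (nhds 1)) ∧
    ∃ C : ℝ, ∀ n x v, |fderiv ℝ (χ n) x v| ≤ ((n : ℝ) + 1)⁻¹ * (C * ‖v‖) := by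
  let b : ContDiffBump (0 : Plane) := ⟨1, 2, by norm_num, by norm_num⟩
  have hb : ContDiff ℝ ∞ b := b.contDiff
  obtain ⟨C, hC⟩ := (b.hasCompactSupport.fderiv ℝ).exists_bound_of_continuous
    (hb.continuous_fderiv (by simp))
  have hn (n : ℕ) : (0 : ℝ) < (n : ℝ) + 1 := by positivity
  refine ⟨fun n x => b (((n : ℝ) + 1)⁻¹ • x), fun n => hb.comp (contDiff_const_smul _), fun n => ?_,
    fun n x => ?_, fun x => ?_, C, fun n x v => ?_⟩
  · exact b.hasCompactSupport.comp_smul (inv_ne_zero (hn n).ne')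
  · rw [abs_of_nonneg b.nonneg]
    exact b.le_one
  · apply tendsto_const_nhds.congr'
    obtain ⟨N, hN⟩ := exists_nat_ge ‖x‖
    filter_upwards [Filter.eventually_ge_atTop N] with n hnN
    refine (b.one_of_mem_closedBall ?_).symm
    rw [mem_closedBall_zero_iff, norm_smul, norm_inv, Real.norm_of_nonneg (hn n).le,
      inv_mul_le_iff₀ (hn n)]
    have : (N : ℝ) ≤ n := by exact_mod_cast hnN
    change ‖x‖ ≤ _ * 1
    linarith
  · have hd : HasFDerivAt (fun x : Plane => b (((n : ℝ) + 1)⁻¹ • x))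
        ((fderiv ℝ b (((n : ℝ) + 1)⁻¹ • x)).comp
          (((n : ℝ) + 1)⁻¹ • ContinuousLinearMap.id ℝ Plane)) x :=
      ((hb.differentiable (by simp)) _).hasFDerivAt.comp x
        ((hasFDerivAt_id x).const_smul (((n : ℝ) + 1)⁻¹))
    rw [hd.fderiv]
    simp only [ContinuousLinearMap.comp_apply, smul_apply,
      ContinuousLinearMap.id_apply, map_smul, smul_eq_mul, abs_mul]
    rw [abs_of_nonneg (inv_nonneg.2 (hn n).le)]
    gcongr
    exact ((fderiv ℝ b _).le_opNorm v).trans (by gcongr; exact hC _)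

/-- On the whole plane, a weak derivative may be tested against smooth functions that are merely
square integrable together with their derivative. -/
theorem IsWeakDeriv.integral_eq_of_memLp {v : Plane} {f g ψ : Plane → ℝ}
    (h : IsWeakDeriv univ v f g) (hf : MemLp f 2) (hg : MemLp g 2) (hψ : ContDiff ℝ ∞ ψ)
    (hψ2 : MemLp ψ 2) (hψ' : MemLp (fun x => fderiv ℝ ψ x v) 2) :
    ∫ x, fderiv ℝ ψ x v * f x = - ∫ x, ψ x * g x := by
  obtain ⟨χ, hχ, hχs, hχ1, hχt, C, hC⟩ := exists_cutoff
  have hd (n : ℕ) (x : Plane) : fderiv ℝ (fun x => χ n x * ψ x) x v =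
      χ n x * fderiv ℝ ψ x v + ψ x * fderiv ℝ (χ n) x v := by
    have h1 := ((hχ n).differentiable (by simp) x).hasFDerivAt
    have h2 := (hψ.differentiable (by simp) x).hasFDerivAt
    have h3 : HasFDerivAt (fun x => χ n x * ψ x)
      (χ n x • fderiv ℝ ψ x + ψ x • fderiv ℝ (χ n) x) x := h1.mul h2
    rw [h3.fderiv]
    simp
  have hfd : AEStronglyMeasurable (fun x => fderiv ℝ ψ x v) := hψ'.1
  have hχd (n : ℕ) : Continuous (fun x => fderiv ℝ (χ n) x v) :=
    ((hχ n).continuous_fderiv (by simp)).clm_apply continuous_const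
  have hn : Filter.Tendsto (fun n : ℕ => ((n : ℝ) + 1)⁻¹) Filter.atTop (nhds 0) := by
    simpa using tendsto_one_div_add_atTop_nhds_zero_nat (𝕜 := ℝ)
  have hn1 (n : ℕ) : ((n : ℝ) + 1)⁻¹ ≤ 1 := inv_le_one_of_one_le₀ (by
    have : (0 : ℝ) ≤ n := n.cast_nonneg
    linarith)
  have hC0 : 0 ≤ C * ‖v‖ := by
    have := (abs_nonneg _).trans (hC 0 0 v)
    simpa using this
  -- The tested identity for the compactly supported functions `χ n * ψ`, passed to the limit below.
  have e (n : ℕ) : ∫ x, (χ n x * fderiv ℝ ψ x v + ψ x * fderiv ℝ (χ n) x v) * f x =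
      - ∫ x, (χ n x * ψ x) * g x := by
    have := h (fun x => χ n x * ψ x) ((hχ n).mul hψ) ((hχs n).mul_right) (subset_univ _)
    simpa only [hd, Measure.restrict_univ, smul_eq_mul] using this
  have i1 : Integrable (fun x => |fderiv ℝ ψ x v * f x| + C * ‖v‖ * |ψ x * f x|) :=
    (hψ'.integrable_mul hf).norm.add ((hψ2.integrable_mul hf).norm.const_mul _)
  have i2 : Integrable (fun x => |ψ x * g x|) := (hψ2.integrable_mul hg).norm
  have t1 := tendsto_integral_of_dominated_convergence (μ := volume)
    (F := fun n x => (χ n x * fderiv ℝ ψ x v + ψ x * fderiv ℝ (χ n) x v) * f x)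
    (f := fun x => fderiv ℝ ψ x v * f x) _
    (fun n => ((((hχ n).continuous.aestronglyMeasurable).mul hfd).add
      (hψ.continuous.aestronglyMeasurable.mul (hχd n).aestronglyMeasurable)).mul hf.1) i1
    (fun n => .of_forall fun x => ?_) (.of_forall fun x => ?_)
  · have t2 := tendsto_integral_of_dominated_convergence (μ := volume)
      (F := fun n x => (χ n x * ψ x) * g x)
      (f := fun x => ψ x * g x) _
      (fun n => (((hχ n).continuous.aestronglyMeasurable).mul
        hψ.continuous.aestronglyMeasurable).mul hg.1) i2
      (fun n => .of_forall fun x => ?_) (.of_forall fun x => ?_)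
    · simp only [e] at t1
      exact tendsto_nhds_unique t1 t2.neg
    · rw [Real.norm_eq_abs, mul_assoc, abs_mul]
      exact mul_le_of_le_one_left (abs_nonneg _) (hχ1 n x)
    · have := ((hχt x).mul_const (ψ x)).mul_const (g x)
      rwa [one_mul] at this
  · rw [Real.norm_eq_abs, add_mul]
    refine (abs_add_le _ _).trans (add_le_add ?_ ?_)
    · rw [mul_assoc, abs_mul]
      exact mul_le_of_le_one_left (abs_nonneg _) (hχ1 n x)
    · rw [mul_right_comm, abs_mul, mul_comm]
      gcongr
      exact (hC n x v).trans (mul_le_of_le_one_left hC0 (hn1 n))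
  · have h0 : Filter.Tendsto (fun n => fderiv ℝ (χ n) x v) Filter.atTop (nhds 0) := by
      refine squeeze_zero_norm (fun n => hC n x v) ?_
      simpa using hn.mul_const (C * ‖v‖)
    have := (((hχt x).mul_const (fderiv ℝ ψ x v)).add (h0.const_mul (ψ x))).mul_const (f x)
    rwa [one_mul, mul_zero, add_zero] at this

/-- Convolution moves a derivative from the kernel to a weakly differentiable function. -/
theorem gconv_weakDeriv {K K' f g : Plane → ℝ} {v : Plane} (hK : GaussBounded K)
    (hK' : GaussBounded K') (hs : ContDiff ℝ ∞ K) (h : ∀ x, HasLineDerivAt ℝ K (K' x) x v)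
    (hf : MemLp f 2) (hg : MemLp g 2) (hw : IsWeakDeriv univ v f g) (x : Plane) :
    gconv K' f x = gconv K g x := by
  have hc : ContDiff ℝ ∞ fun y : Plane => K (x - y) := hs.comp (contDiff_const.sub contDiff_id)
  have hd (y : Plane) : fderiv ℝ (fun y => K (x - y)) y v = -K' (x - y) := by
    have h1 : HasFDerivAt (fun y => K (x - y)) ((fderiv ℝ K (x - y)).comp
        (-ContinuousLinearMap.id ℝ Plane)) y :=
      ((hs.differentiable (by simp)) _).hasFDerivAt.comp y ((hasFDerivAt_id y).const_sub x)
    rw [h1.fderiv]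
    have h2 := (((hs.differentiable (by simp)) (x - y)).hasFDerivAt.hasLineDerivAt v).unique
      (h (x - y))
    simp [h2]
  have m (L : Plane → ℝ) (hL : GaussBounded L) : MemLp (fun y => L (x - y)) 2 :=
    hL.memLp.comp_measurePreserving (volume.measurePreserving_sub_left x)
  have := hw.integral_eq_of_memLp hf hg hc (m K hK) (by
    simp only [hd]
    exact (m K' hK').neg)
  simp only [hd, neg_mul, integral_neg, neg_inj] at this
  exact this

/-! ### Curves in `L²` -/

section Curves

variable {α : Type*} [MeasurableSpace α] {μ : Measure α}

/-- The class in `L²(μ)` of a square integrable function; zero for other functions. -/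
def lpOf (μ : Measure α) (f : α → ℝ) : Lp ℝ 2 μ :=
  open Classical in if h : MemLp f 2 μ then h.toLp f else 0

theorem lpOf_eq {f : α → ℝ} (h : MemLp f 2 μ) : lpOf μ f = h.toLp f := dif_pos h

theorem coeFn_lpOf {f : α → ℝ} (h : MemLp f 2 μ) : lpOf μ f =ᵐ[μ] f := by
  rw [lpOf_eq h]
  exact h.coeFn_toLp

theorem lpOf_norm_le {f B : α → ℝ} (hf : MemLp f 2 μ) (hB : MemLp B 2 μ) {c : ℝ}
    (hc : 0 ≤ c) (h : ∀ᵐ x ∂μ, |f x| ≤ c * B x) : ‖lpOf μ f‖ ≤ c * ‖lpOf μ B‖ := by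
  apply Lp.norm_le_mul_norm_of_ae_le_mul
  filter_upwards [h, coeFn_lpOf hf, coeFn_lpOf hB] with x h1 h2 h3
  rw [h2, h3, Real.norm_eq_abs, Real.norm_eq_abs]
  exact h1.trans (mul_le_mul_of_nonneg_left (le_abs_self _) hc)

theorem lpOf_norm_sq {f : α → ℝ} (hf : MemLp f 2 μ) : ‖lpOf μ f‖ ^ 2 = ∫ x, f x ^ 2 ∂μ := by
  rw [← real_inner_self_eq_norm_sq, L2.inner_def]
  apply integral_congr_ae
  filter_upwards [coeFn_lpOf hf] with x h
  rw [h]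
  simp [sq]

theorem lpOf_inner {f g : α → ℝ} (hf : MemLp f 2 μ) (hg : MemLp g 2 μ) :
    inner ℝ (lpOf μ f) (lpOf μ g) = ∫ x, f x * g x ∂μ := by
  rw [L2.inner_def]
  apply integral_congr_ae
  filter_upwards [coeFn_lpOf hf, coeFn_lpOf hg] with x h h'
  rw [h, h']
  simp [mul_comm]

theorem lpOf_add {f g : α → ℝ} (hf : MemLp f 2 μ) (hg : MemLp g 2 μ) :
    lpOf μ (fun x => f x + g x) = lpOf μ f + lpOf μ g := by
  rw [lpOf_eq hf, lpOf_eq hg]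
  exact lpOf_eq (hf.add hg)

theorem lpOf_sub {f g : α → ℝ} (hf : MemLp f 2 μ) (hg : MemLp g 2 μ) :
    lpOf μ (fun x => f x - g x) = lpOf μ f - lpOf μ g := by
  rw [lpOf_eq hf, lpOf_eq hg]
  exact lpOf_eq (hf.sub hg)

theorem lpOf_const_mul {f : α → ℝ} (hf : MemLp f 2 μ) (c : ℝ) :
    lpOf μ (fun x => c * f x) = c • lpOf μ f := by
  rw [lpOf_eq hf]
  exact lpOf_eq (hf.const_mul c)

theorem lpOf_lipschitz {h : ℝ → α → ℝ} {B : α → ℝ} {s t : ℝ} (hs : MemLp (h s) 2 μ)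
    (ht : MemLp (h t) 2 μ) (hB : MemLp B 2 μ)
    (hl : ∀ᵐ x ∂μ, |h s x - h t x| ≤ |s - t| * B x) :
    ‖lpOf μ (h s) - lpOf μ (h t)‖ ≤ |s - t| * ‖lpOf μ B‖ := by
  rw [← lpOf_sub hs ht]
  exact lpOf_norm_le (hs.sub ht) hB (abs_nonneg _) hl

/-- A curve of square integrable functions that is pointwise differentiable, with a derivative that
is Lipschitz in time with an `L²` Lipschitz constant, is differentiable in `L²`. -/
theorem lpOf_hasDerivAt {a b : ℝ} {h h' : ℝ → α → ℝ} {B : α → ℝ}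
    (mh : ∀ t ∈ Ioo a b, MemLp (h t) 2 μ) (mh' : ∀ t ∈ Ioo a b, MemLp (h' t) 2 μ)
    (mB : MemLp B 2 μ)
    (hd : ∀ᵐ x ∂μ, ∀ t ∈ Ioo a b, HasDerivAt (fun t => h t x) (h' t x) t)
    (hl : ∀ᵐ x ∂μ, ∀ s ∈ Ioo a b, ∀ t ∈ Ioo a b, |h' s x - h' t x| ≤ |s - t| * B x)
    {t : ℝ} (ht : t ∈ Ioo a b) :
    HasDerivAt (fun t => lpOf μ (h t)) (lpOf μ (h' t)) t := by
  rw [hasDerivAt_iff_isLittleO]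
  have key : ∀ s ∈ Ioo a b,
      ‖lpOf μ (h s) - lpOf μ (h t) - (s - t) • lpOf μ (h' t)‖ ≤ ‖lpOf μ B‖ * ‖(s - t) ^ 2‖ := by
    intro s hs
    rw [← lpOf_sub (mh s hs) (mh t ht), ← lpOf_const_mul (mh' t ht),
      ← lpOf_sub (f := fun x => h s x - h t x) ((mh s hs).sub (mh t ht))
        ((mh' t ht).const_mul _), mul_comm]
    refine lpOf_norm_le (((mh s hs).sub (mh t ht)).sub ((mh' t ht).const_mul _)) mB (norm_nonneg _) ?_
    filter_upwards [hd, hl] with x hd hl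
    have hsub : uIcc t s ⊆ Ioo a b := (convex_Ioo a b).ordConnected.uIcc_subset ht hs
    have := (convex_uIcc t s).norm_image_sub_le_of_norm_hasDerivWithin_le
      (f := fun r => h r x - r * h' t x) (f' := fun r => h' r x - 1 * h' t x)
      (C := |s - t| * B x)
      (fun r hr => ((hd r (hsub hr)).sub ((hasDerivAt_id r).mul_const (h' t x))).hasDerivWithinAt)
      (fun r hr => ?_) left_mem_uIcc right_mem_uIcc
    · rw [Real.norm_eq_abs, Real.norm_eq_abs] at this
      calc |h s x - h t x - (s - t) * h' t x|
          = |h s x - s * h' t x - (h t x - t * h' t x)| := by congr 1; ring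
        _ ≤ |s - t| * B x * |s - t| := this
        _ = ‖(s - t) ^ 2‖ * B x := by rw [norm_pow, Real.norm_eq_abs]; ring
    · rw [one_mul]
      refine (hl r (hsub hr) t ht).trans ?_
      rcases eq_or_ne s t with rfl | hst
      · simp at hr
        simp [hr]
      · have hB : 0 ≤ B x := by
          have := (abs_nonneg _).trans (hl s hs t ht)
          exact nonneg_of_mul_nonneg_right this (abs_pos.2 (sub_ne_zero.2 hst))
        exact mul_le_mul_of_nonneg_right (abs_sub_left_of_mem_uIcc hr) hB
  refine (Asymptotics.IsBigO.of_bound ‖lpOf μ B‖ ?_).trans_isLittleO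
    (g := fun s => (s - t) ^ 2) ?_
  · filter_upwards [Ioo_mem_nhds ht.1 ht.2] with s hs using key s hs
  · have h1 : (fun s : ℝ => s - t) =o[nhds t] fun _ => (1 : ℝ) := by
      rw [Asymptotics.isLittleO_one_iff]
      have : Filter.Tendsto (fun s : ℝ => s - t) (nhds t) (nhds (t - t)) :=
        (continuous_id.sub continuous_const).tendsto t
      rwa [sub_self] at this
    simpa [sq] using h1.mul_isBigO (Asymptotics.isBigO_refl (fun s : ℝ => s - t) (nhds t))

end Curves

/-- A continuously differentiable curve has its classical derivative as weak derivative. -/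
theorem isWeakDeriv_of_hasDerivAt {F : Type*} [NormedAddCommGroup F] [NormedSpace ℝ F]
    [CompleteSpace F] {a b : ℝ} {u u' : ℝ → F} (hd : ∀ t ∈ Ioo a b, HasDerivAt u (u' t) t)
    (hc : ContinuousOn u' (Ioo a b)) : IsWeakDeriv (Ioo a b) (1 : ℝ) u u' := by
  intro ψ hψ hs hU
  have hψ' : Continuous fun t => fderiv ℝ ψ t 1 :=
    (hψ.continuous_fderiv (by simp)).clm_apply continuous_const
  have hz : ∀ t ∉ tsupport ψ, ψ t = 0 := fun t ht => image_eq_zero_of_notMem_tsupport ht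
  have hz' : ∀ t ∉ tsupport ψ, fderiv ℝ ψ t 1 = 0 := fun t ht => by
    rw [image_eq_zero_of_notMem_tsupport fun h => ht (tsupport_fderiv_subset ℝ h)]
    simp
  have hcu : ContinuousOn u (Ioo a b) := fun t ht => (hd t ht).continuousAt.continuousWithinAt
  have hcont (χ : ℝ → ℝ) (hχ : Continuous χ) (hχ0 : ∀ t ∉ tsupport ψ, χ t = 0) (w : ℝ → F)
      (hw : ContinuousOn w (Ioo a b)) : Continuous fun t => χ t • w t := by
    rw [continuous_iff_continuousAt]
    intro t
    by_cases ht : t ∈ tsupport ψ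
    · exact hχ.continuousAt.smul (hw.continuousAt (isOpen_Ioo.mem_nhds (hU ht)))
    · refine (continuousAt_const (y := (0 : F))).congr ?_
      filter_upwards [(isClosed_tsupport ψ).isOpen_compl.mem_nhds ht] with s hs
      rw [hχ0 s hs, zero_smul]
  have hint (χ : ℝ → ℝ) (hχ : Continuous χ) (hχ0 : ∀ t ∉ tsupport ψ, χ t = 0) (w : ℝ → F)
      (hw : ContinuousOn w (Ioo a b)) : Integrable fun t => χ t • w t := by
    refine (hcont χ hχ hχ0 w hw).integrable_of_hasCompactSupport
      (HasCompactSupport.intro hs fun t ht => ?_)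
    rw [hχ0 t ht, zero_smul]
  have i1 := hint _ hψ' hz' u hcu
  have i2 := hint _ hψ.continuous hz u' hc
  have i3 := hint _ hψ.continuous hz u hcu
  have hD (t : ℝ) : HasDerivAt (fun t => ψ t • u t) (ψ t • u' t + fderiv ℝ ψ t 1 • u t) t := by
    by_cases ht : t ∈ tsupport ψ
    · have := (hψ.differentiable (by simp) t).hasDerivAt
      rw [← fderiv_apply_one_eq_deriv] at this
      exact this.smul (hd t (hU ht))
    · rw [hz t ht, hz' t ht, zero_smul, zero_smul, add_zero]
      refine (hasDerivAt_const t (0 : F)).congr_of_eventuallyEq ?_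
      filter_upwards [(isClosed_tsupport ψ).isOpen_compl.mem_nhds ht] with s hs
      rw [hz s hs, zero_smul]
  have h0 := integral_eq_zero_of_hasDerivAt_of_integrable hD (i2.add i1) i3
  rw [integral_add i2 i1] at h0
  rw [setIntegral_eq_integral_of_forall_compl_eq_zero,
    setIntegral_eq_integral_of_forall_compl_eq_zero]
  · exact eq_neg_of_add_eq_zero_right h0
  · intro t ht
    rw [hz t fun h => ht (hU h), zero_smul]
  · intro t ht
    rw [hz' t fun h => ht (hU h), zero_smul]

/-! ### The Hilbert space `H²` -/

theorem continuous_integral_test_smul {U : Set Plane} {χ : Plane → ℝ} (hc : Continuous χ)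
    (hs : HasCompactSupport χ) : Continuous fun f : L2Space U => ∫ x in U, χ x • f x := by
  have h : MemLp χ 2 (volume.restrict U) := hc.memLp_of_hasCompactSupport hs
  have e (f : L2Space U) :
      ∫ x in U, χ x • f x = inner ℝ (lpOf (volume.restrict U) χ) f := by
    rw [L2.inner_def]
    apply integral_congr_ae
    filter_upwards [coeFn_lpOf h] with x hx
    rw [hx]
    simp [mul_comm]
  simp only [e]
  fun_prop

/-- Weak differentiability is a closed condition in `L²`, being tested by continuous functionals. -/
theorem isClosed_isWeakDeriv {U : Set Plane} {v : Plane} {X : Type*} [TopologicalSpace X]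
    {f g : X → L2Space U} (hf : Continuous f) (hg : Continuous g) :
    IsClosed {w : X | IsWeakDeriv U v (f w) (g w)} := by
  simp only [IsWeakDeriv, ofPred_forall]
  refine isClosed_iInter fun ψ => isClosed_iInter fun hψ => isClosed_iInter fun hs =>
    isClosed_iInter fun _ => isClosed_eq ?_ ?_
  · exact (continuous_integral_test_smul
      ((hψ.continuous_fderiv (by simp)).clm_apply continuous_const)
      (hs.fderiv_apply (𝕜 := ℝ) v)).comp hf
  · exact ((continuous_integral_test_smul hψ.continuous hs).comp hg).neg

theorem H2Space.isClosed (U : Set Plane) : IsClosed (H2Space U : Set (JetSpace U)) := by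
  have hp (κ : JetIndex) : Continuous fun w : JetSpace U => w κ :=
    PiLp.continuous_apply 2 (fun _ : JetIndex => L2Space U) κ
  have h : (H2Space U : Set (JetSpace U)) =
      (⋂ i : Fin 2, {w : JetSpace U | IsWeakDeriv U (unitVec i) (w (Sum.inl ()))
        (w (Sum.inr (Sum.inl i)))}) ∩
      ⋂ i : Fin 2, ⋂ j : Fin 2, {w : JetSpace U | IsWeakDeriv U (unitVec j)
        (w (Sum.inr (Sum.inl i))) (w (Sum.inr (Sum.inr (i, j))))} := by
    ext w
    simp only [mem_inter_iff, mem_iInter]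
    rfl
  rw [h]
  exact (isClosed_iInter fun i => isClosed_isWeakDeriv (hp _) (hp _)).inter
    (isClosed_iInter fun i => isClosed_iInter fun j => isClosed_isWeakDeriv (hp _) (hp _))

instance (U : Set Plane) : CompleteSpace (H2Space U) := (H2Space.isClosed U).completeSpace_coe

instance (U : Set Plane) : SecondCountableTopologyEither ℝ (H2Space U) :=
  secondCountableTopologyEither_of_left ℝ (H2Space U)

/-- A component of the jet of an element of `H²(U)`, as a continuous linear map. -/
def H2Space.component (U : Set Plane) (κ : JetIndex) : H2Space U →L[ℝ] L2Space U :=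
  (PiLp.proj 2 (fun _ : JetIndex => L2Space U) κ).comp (H2Space U).subtypeL

/-- The Laplacian `H²(U) → L²(U)` as a continuous linear map. -/
def H2Space.laplacianCLM (U : Set Plane) : H2Space U →L[ℝ] L2Space U :=
  ∑ i : Fin 2, H2Space.component U (Sum.inr (Sum.inr (i, i)))

theorem H2Space.laplacianCLM_apply {U : Set Plane} (w : H2Space U) :
    H2Space.laplacianCLM U w = H2Space.laplacian w := by
  simp [H2Space.laplacianCLM, H2Space.laplacian, H2Space.component]

theorem H2Space.norm_sq_eq {U : Set Plane} (w : H2Space U) :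
    ‖w‖ ^ 2 = ∑ κ : JetIndex, ‖H2Space.component U κ w‖ ^ 2 :=
  PiLp.norm_sq_eq_of_L2 (fun _ : JetIndex => L2Space U) w.1

/-- The family `f` consists of square integrable functions on `U`, the weak derivatives of order at
most two of the function of index `Sum.inl ()`. -/
structure IsJet (U : Set Plane) (f : JetIndex → Plane → ℝ) : Prop where
  memLp : ∀ κ, MemLp (f κ) 2 (volume.restrict U)
  first : ∀ i : Fin 2, IsWeakDeriv U (unitVec i) (f (Sum.inl ())) (f (Sum.inr (Sum.inl i)))
  second : ∀ i j : Fin 2,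
    IsWeakDeriv U (unitVec j) (f (Sum.inr (Sum.inl i))) (f (Sum.inr (Sum.inr (i, j))))

theorem IsWeakDeriv.congr_ae {U : Set Plane} {v : Plane} {f g f' g' : Plane → ℝ}
    (h : IsWeakDeriv U v f g) (hf : f' =ᵐ[volume.restrict U] f)
    (hg : g' =ᵐ[volume.restrict U] g) : IsWeakDeriv U v f' g' := by
  intro ψ hψ hs hU
  have e1 : ∫ x in U, fderiv ℝ ψ x v • f' x = ∫ x in U, fderiv ℝ ψ x v • f x :=
    integral_congr_ae (hf.mono fun x hx => by simp only [hx])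
  have e2 : ∫ x in U, ψ x • g' x = ∫ x in U, ψ x • g x :=
    integral_congr_ae (hg.mono fun x hx => by simp only [hx])
  rw [e1, e2, h ψ hψ hs hU]

/-- The element of `H²(U)` given by a family of functions, zero unless the family is a jet. -/
def mkH2 (U : Set Plane) (f : JetIndex → Plane → ℝ) : H2Space U :=
  open Classical in
  if h : WithLp.toLp 2 (fun κ => lpOf (volume.restrict U) (f κ)) ∈ H2Space U then ⟨_, h⟩ else 0

theorem IsJet.mem {U : Set Plane} {f : JetIndex → Plane → ℝ} (hf : IsJet U f) :
    WithLp.toLp 2 (fun κ => lpOf (volume.restrict U) (f κ)) ∈ H2Space U :=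
  ⟨fun i => (hf.first i).congr_ae (coeFn_lpOf (hf.memLp _)) (coeFn_lpOf (hf.memLp _)),
    fun i j => (hf.second i j).congr_ae (coeFn_lpOf (hf.memLp _)) (coeFn_lpOf (hf.memLp _))⟩

theorem IsJet.mkH2_val {U : Set Plane} {f : JetIndex → Plane → ℝ} (hf : IsJet U f) :
    (mkH2 U f).1 = WithLp.toLp 2 (fun κ => lpOf (volume.restrict U) (f κ)) := by
  rw [mkH2, dif_pos hf.mem]

theorem IsJet.component_mkH2 {U : Set Plane} {f : JetIndex → Plane → ℝ} (hf : IsJet U f)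
    (κ : JetIndex) : H2Space.component U κ (mkH2 U f) = lpOf (volume.restrict U) (f κ) := by
  change (mkH2 U f).1 κ = _
  rw [hf.mkH2_val]

theorem IsJet.toL2_mkH2 {U : Set Plane} {f : JetIndex → Plane → ℝ} (hf : IsJet U f) :
    H2Space.toL2 (mkH2 U f) = lpOf (volume.restrict U) (f (Sum.inl ())) :=
  hf.component_mkH2 (Sum.inl ())

theorem IsJet.laplacian_mkH2 {U : Set Plane} {f : JetIndex → Plane → ℝ} (hf : IsJet U f) :
    H2Space.laplacian (mkH2 U f) =
      ∑ i : Fin 2, lpOf (volume.restrict U) (f (Sum.inr (Sum.inr (i, i)))) :=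
  Finset.sum_congr rfl fun _ _ => hf.component_mkH2 _

theorem H2Space.norm_le {U : Set Plane} (w : H2Space U) {C : ℝ}
    (h : ∀ κ, ‖H2Space.component U κ w‖ ≤ C) : ‖w‖ ≤ Fintype.card JetIndex * C := by
  have hC : 0 ≤ C := (norm_nonneg _).trans (h (Sum.inl ()))
  have h1 : (1 : ℝ) ≤ Fintype.card JetIndex := by
    exact_mod_cast Fintype.card_pos_iff.2 ⟨Sum.inl ()⟩
  refine abs_le_of_sq_le_sq' ?_ (by positivity) |>.2
  calc ‖w‖ ^ 2 = ∑ κ : JetIndex, ‖H2Space.component U κ w‖ ^ 2 := H2Space.norm_sq_eq w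
    _ ≤ ∑ _κ : JetIndex, C ^ 2 := Finset.sum_le_sum fun κ _ => by
        gcongr
        exact h κ
    _ = Fintype.card JetIndex * C ^ 2 := by simp
    _ ≤ (Fintype.card JetIndex * C) ^ 2 := by
        rw [mul_pow]
        gcongr
        nlinarith

theorem continuousOn_mkH2 {U : Set Plane} {s : Set ℝ} {f : ℝ → JetIndex → Plane → ℝ}
    (hf : ∀ t ∈ s, IsJet U (f t))
    (hc : ∀ κ, ContinuousOn (fun t => lpOf (volume.restrict U) (f t κ)) s) :
    ContinuousOn (fun t => mkH2 U (f t)) s := by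
  rw [Topology.IsInducing.subtypeVal.continuousOn_iff]
  have : ContinuousOn (fun t => WithLp.toLp 2 (fun κ => lpOf (volume.restrict U) (f t κ))) s :=
    (PiLp.continuous_toLp 2 (fun _ : JetIndex => L2Space U)).comp_continuousOn
      (continuousOn_pi.2 hc)
  exact this.congr fun t ht => (hf t ht).mkH2_val

theorem setIntegral_smul_eq_of_forall_notMem {U : Set Plane} {χ f : Plane → ℝ}
    (h : ∀ x ∉ U, χ x = 0) : ∫ x in U, χ x • f x = ∫ x, χ x * f x :=
  setIntegral_eq_integral_of_forall_compl_eq_zero fun x hx => by rw [h x hx, zero_smul]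

/-- A classical directional derivative is a weak derivative. -/
theorem isWeakDeriv_of_hasLineDerivAt {U : Set Plane} {v : Plane} {f g : Plane → ℝ}
    (hf : MemLp f 2) (hg : MemLp g 2) (h : ∀ x, HasLineDerivAt ℝ f (g x) x v) :
    IsWeakDeriv U v f g := by
  intro ψ hψ hs hU
  have hψ' : Continuous fun x => fderiv ℝ ψ x v :=
    (hψ.continuous_fderiv (by simp)).clm_apply continuous_const
  have m1 : MemLp (fun x => fderiv ℝ ψ x v) 2 :=
    hψ'.memLp_of_hasCompactSupport (hs.fderiv_apply (𝕜 := ℝ) v)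
  have m2 : MemLp ψ 2 := hψ.continuous.memLp_of_hasCompactSupport hs
  rw [setIntegral_smul_eq_of_forall_notMem, setIntegral_smul_eq_of_forall_notMem]
  · have := integral_bilinear_hasLineDerivAt_right_eq_neg_left_of_integrable
      (μ := (volume : Measure Plane)) (B := ContinuousLinearMap.mul ℝ ℝ) (v := v)
      (f := ψ) (f' := fun x => fderiv ℝ ψ x v) (g := f) (g' := g)
      (m1.integrable_mul hf) (m2.integrable_mul hg) (m2.integrable_mul hf)
      (fun x _ => ((hψ.differentiable (by simp)) x).hasFDerivAt.hasLineDerivAt v) (fun x _ => h x)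
    simp only [ContinuousLinearMap.mul_apply'] at this
    rw [this, neg_neg]
  · exact fun x hx => image_eq_zero_of_notMem_tsupport fun h => hx (hU h)
  · intro x hx
    rw [image_eq_zero_of_notMem_tsupport fun h => hx (hU (tsupport_fderiv_subset ℝ h))]
    simp

theorem jetKernel_gaussBounded {d t : ℝ} (hd : 0 < d) (ht : 0 < t) (κ : JetIndex) :
    GaussBounded (jetKernel d κ t) := gaussKernels_gaussBounded hd ht (jetKernel_mem d κ)

theorem isJet_jetKernel {d t : ℝ} (hd : 0 < d) (ht : 0 < t) (U : Set Plane) :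
    IsJet U fun κ => jetKernel d κ t where
  memLp κ := (jetKernel_gaussBounded hd ht κ).memLp.restrict U
  first i := isWeakDeriv_of_hasLineDerivAt (jetKernel_gaussBounded hd ht _).memLp
    (jetKernel_gaussBounded hd ht _).memLp fun x => heatKernel_hasLineDerivAt hd ht x i
  second i j := isWeakDeriv_of_hasLineDerivAt (jetKernel_gaussBounded hd ht _).memLp
    (jetKernel_gaussBounded hd ht _).memLp fun x => jetKernel_hasLineDerivAt hd ht x i j

theorem isJet_gconv {d t : ℝ} (hd : 0 < d) (ht : 0 < t) {f : Plane → ℝ} (hf : MemLp f 2)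
    (U : Set Plane) : IsJet U fun κ => gconv (jetKernel d κ t) f where
  memLp κ := ((jetKernel_gaussBounded hd ht κ).young hf).1.restrict U
  first i := isWeakDeriv_of_hasLineDerivAt ((jetKernel_gaussBounded hd ht _).young hf).1
    ((jetKernel_gaussBounded hd ht _).young hf).1
    (gconv_hasLineDerivAt (jetKernel_gaussBounded hd ht _) (jetKernel_gaussBounded hd ht _)
      (fun x => heatKernel_hasLineDerivAt hd ht x i) hf)
  second i j := isWeakDeriv_of_hasLineDerivAt ((jetKernel_gaussBounded hd ht _).young hf).1
    ((jetKernel_gaussBounded hd ht _).young hf).1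
    (gconv_hasLineDerivAt (jetKernel_gaussBounded hd ht _) (jetKernel_gaussBounded hd ht _)
      (fun x => jetKernel_hasLineDerivAt hd ht x i j) hf)

/-! ### The heat semigroup -/

theorem gconv_lipschitz {d ε T : ℝ} (hd : 0 < d) (hε : 0 < ε) (hT : ε ≤ T)
    {K : ℝ → Plane → ℝ} (hK : K ∈ gaussKernels d) {f : Plane → ℝ} (hf : MemLp f 2) :
    ∃ B : Plane → ℝ, MemLp B 2 ∧ ∀ s ∈ Icc ε T, ∀ t ∈ Icc ε T, ∀ x,
      |gconv (K s) f x - gconv (K t) f x| ≤ |s - t| * B x := by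
  obtain ⟨K', hK', h⟩ := gaussKernels_hasDerivAt hd hK
  obtain ⟨C, hC, hb⟩ := gaussKernels_bound_Icc hd hε hT hK'
  have hc : 0 < (8 * d * T)⁻¹ := by
    have := hε.trans_le hT
    positivity
  refine ⟨fun x => C * gconv (gaussMajorant (8 * d * T)⁻¹) (fun y => |f y|) x,
    ((gaussBounded_gaussMajorant hc).young hf.norm).1.const_mul C, fun s hs t ht x => ?_⟩
  have := (convex_Icc ε T).norm_image_sub_le_of_norm_hasDerivWithin_le
    (f := fun r => gconv (K r) f x) (f' := fun r => gconv (K' r) f x)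
    (fun r hr => (gconv_hasDerivAt hd hK hK' h hf (hε.trans_le hr.1) x).hasDerivWithinAt)
    (fun r hr => abs_gconv_le hc (hb r hr) hf x) ht hs
  rw [mul_comm]
  exact this

theorem gconv_memLp {d t : ℝ} (hd : 0 < d) (ht : 0 < t) {K : ℝ → Plane → ℝ}
    (hK : K ∈ gaussKernels d) {f : Plane → ℝ} (hf : MemLp f 2) (U : Set Plane) :
    MemLp (gconv (K t) f) 2 (volume.restrict U) :=
  ((gaussKernels_gaussBounded hd ht hK).young hf).1.restrict U

theorem lpOf_gconv_continuousOn {d : ℝ} (hd : 0 < d) {K : ℝ → Plane → ℝ}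
    (hK : K ∈ gaussKernels d) {f : Plane → ℝ} (hf : MemLp f 2) (U : Set Plane) :
    ContinuousOn (fun t => lpOf (volume.restrict U) (gconv (K t) f)) (Ioi 0) := by
  intro t (ht : 0 < t)
  obtain ⟨B, hB, hl⟩ := gconv_lipschitz (ε := t / 2) (T := 2 * t) hd (by positivity)
    (by linarith) hK hf
  refine ContinuousAt.continuousWithinAt ?_
  rw [ContinuousAt, tendsto_iff_norm_sub_tendsto_zero]
  have ht' : t ∈ Icc (t / 2) (2 * t) := ⟨by linarith, by linarith⟩
  refine squeeze_zero' (g := fun s => |s - t| * ‖lpOf (volume.restrict U) B‖)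
    (.of_forall fun _ => norm_nonneg _) ?_ ?_
  · filter_upwards [Icc_mem_nhds (show t / 2 < t by linarith) (show t < 2 * t by linarith)]
      with s hs
    exact lpOf_lipschitz (h := fun s => gconv (K s) f)
      (gconv_memLp hd (lt_of_lt_of_le (by positivity) hs.1) hK hf U)
      (gconv_memLp hd ht hK hf U) (hB.restrict U) (.of_forall (hl s hs t ht'))
  · have : Filter.Tendsto (fun s => |s - t| * ‖lpOf (volume.restrict U) B‖) (nhds t)
        (nhds (|t - t| * ‖lpOf (volume.restrict U) B‖)) :=
      Continuous.tendsto (by fun_prop) t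
    simpa using this

theorem lpOf_gconv_hasDerivAt {d : ℝ} (hd : 0 < d) {K K' : ℝ → Plane → ℝ}
    (hK : K ∈ gaussKernels d) (hK' : K' ∈ gaussKernels d)
    (h : ∀ t, 0 < t → ∀ x, HasDerivAt (fun t => K t x) (K' t x) t) {f : Plane → ℝ}
    (hf : MemLp f 2) (U : Set Plane) {t : ℝ} (ht : 0 < t) :
    HasDerivAt (fun t => lpOf (volume.restrict U) (gconv (K t) f))
      (lpOf (volume.restrict U) (gconv (K' t) f)) t := by
  obtain ⟨B, hB, hl⟩ := gconv_lipschitz (ε := t / 2) (T := 2 * t) hd (by positivity)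
    (by linarith) hK' hf
  have hpos : ∀ s ∈ Ioo (t / 2) (2 * t), 0 < s := fun s hs => lt_trans (by positivity) hs.1
  exact lpOf_hasDerivAt (h := fun t => gconv (K t) f) (h' := fun t => gconv (K' t) f)
    (fun s hs => gconv_memLp hd (hpos s hs) hK hf U)
    (fun s hs => gconv_memLp hd (hpos s hs) hK' hf U) (hB.restrict U)
    (.of_forall fun x s hs => gconv_hasDerivAt hd hK hK' h hf (hpos s hs) x)
    (.of_forall fun x s hs r hr => hl s (Ioo_subset_Icc_self hs) r (Ioo_subset_Icc_self hr) x)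
    ⟨by linarith, by linarith⟩

/-- The kernel `d Δ G`, the time derivative of the heat kernel. -/
def heatKernelDeriv (d : ℝ) : ℝ → Plane → ℝ :=
  d • ∑ i : Fin 2, jetKernel d (Sum.inr (Sum.inr (i, i)))

theorem heatKernelDeriv_mem (d : ℝ) : heatKernelDeriv d ∈ gaussKernels d :=
  Submodule.smul_mem _ _ (Submodule.sum_mem _ fun _ _ => jetKernel_mem d _)

theorem heatKernelDeriv_apply (d t : ℝ) (x : Plane) : heatKernelDeriv d t x =
    d * (jetKernel d (Sum.inr (Sum.inr (0, 0))) t x +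
      jetKernel d (Sum.inr (Sum.inr (1, 1))) t x) := by
  simp [heatKernelDeriv, Fin.sum_univ_two]

theorem heatKernel_hasDerivAt' {d t : ℝ} (hd : 0 < d) (ht : 0 < t) (x : Plane) :
    HasDerivAt (fun t => heatKernel d t x) (heatKernelDeriv d t x) t := by
  rw [heatKernelDeriv_apply, ← Fin.sum_univ_two
    (f := fun i : Fin 2 => jetKernel d (Sum.inr (Sum.inr (i, i))) t x)]
  exact heatKernel_hasDerivAt hd ht x

theorem lpOf_lincomb {α : Type*} [MeasurableSpace α] {μ : Measure α} {d : ℝ}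
    {h : Fin 2 → α → ℝ} (hh : ∀ i, MemLp (h i) 2 μ) :
    lpOf μ (fun x => d * (h 0 x + h 1 x)) = d • ∑ i : Fin 2, lpOf μ (h i) := by
  rw [lpOf_const_mul (f := fun x => h 0 x + h 1 x) ((hh 0).add (hh 1)),
    lpOf_add (hh 0) (hh 1), Fin.sum_univ_two]

theorem gconv_heatKernelDeriv {d t : ℝ} (hd : 0 < d) (ht : 0 < t) {f : Plane → ℝ}
    (hf : MemLp f 2) : gconv (heatKernelDeriv d t) f = fun x =>
      d * (gconv (jetKernel d (Sum.inr (Sum.inr (0, 0))) t) f x +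
        gconv (jetKernel d (Sum.inr (Sum.inr (1, 1))) t) f x) := by
  ext x
  unfold gconv
  rw [← integral_add ((jetKernel_gaussBounded hd ht _).integrable_mul hf x)
    ((jetKernel_gaussBounded hd ht _).integrable_mul hf x), ← integral_const_mul]
  refine integral_congr_ae (.of_forall fun y => ?_)
  simp only [heatKernelDeriv_apply]
  ring

/-- The `L²(U)`-valued curve `t ↦ G_t * f` solves the heat equation. -/
theorem lpOf_heat_hasDerivAt {d : ℝ} (hd : 0 < d) {f : Plane → ℝ} (hf : MemLp f 2)
    (U : Set Plane) {t : ℝ} (ht : 0 < t) :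
    HasDerivAt (fun t => lpOf (volume.restrict U) (gconv (heatKernel d t) f))
      (d • ∑ i : Fin 2, lpOf (volume.restrict U)
        (gconv (jetKernel d (Sum.inr (Sum.inr (i, i))) t) f)) t := by
  have h := lpOf_gconv_hasDerivAt hd (jetKernel_mem d (Sum.inl ())) (heatKernelDeriv_mem d)
    (fun t ht x => heatKernel_hasDerivAt' hd ht x) hf U ht
  rw [gconv_heatKernelDeriv hd ht hf, lpOf_lincomb
    (h := fun i => gconv (jetKernel d (Sum.inr (Sum.inr (i, i))) t) f)
    (fun i => gconv_memLp hd ht (jetKernel_mem d _) hf U)] at h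
  exact h

theorem integral_abs_heatKernel {d t : ℝ} (hd : 0 < d) (ht : 0 < t) :
    ∫ x, |heatKernel d t x| = 1 := by
  have e (x : Plane) : |heatKernel d t x| =
      (4 * Real.pi * d * t)⁻¹ * gaussMajorant (4 * d * t)⁻¹ x := by
    rw [abs_of_nonneg (by unfold heatKernel; positivity)]
    unfold heatKernel gaussMajorant
    rw [neg_div, div_eq_inv_mul]
  simp only [e]
  rw [integral_const_mul, gaussMajorant_integral (by positivity)]
  have := Real.pi_pos
  field_simp

theorem integral_sq_gconv_heatKernel_le {d t : ℝ} (hd : 0 < d) (ht : 0 < t) {f : Plane → ℝ}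
    (hf : MemLp f 2) : ∫ x, gconv (heatKernel d t) f x ^ 2 ≤ ∫ x, f x ^ 2 := by
  have := ((jetKernel_gaussBounded hd ht (Sum.inl ())).young hf).2
  change ∫ x, gconv (heatKernel d t) f x ^ 2 ≤ (∫ z, |heatKernel d t z|) ^ 2 * _ at this
  rwa [integral_abs_heatKernel hd ht, one_pow, one_mul] at this

/-- Integration by parts `⟨u, ∂ᵢ∂ᵢu⟩ = -‖∂ᵢu‖²` for `u = G_t * f`. -/
theorem integral_gconv_mul_second {d t : ℝ} (hd : 0 < d) (ht : 0 < t) {f : Plane → ℝ}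
    (hf : MemLp f 2) (i : Fin 2) :
    ∫ x, gconv (heatKernel d t) f x * gconv (jetKernel d (Sum.inr (Sum.inr (i, i))) t) f x =
      - ∫ x, gconv (jetKernel d (Sum.inr (Sum.inl i)) t) f x ^ 2 := by
  have m (κ : JetIndex) := ((jetKernel_gaussBounded hd ht κ).young hf).1
  have l1 := gconv_hasLineDerivAt (jetKernel_gaussBounded hd ht (Sum.inl ()))
    (jetKernel_gaussBounded hd ht (Sum.inr (Sum.inl i)))
    (fun x => heatKernel_hasLineDerivAt hd ht x i) hf
  have l2 := gconv_hasLineDerivAt (jetKernel_gaussBounded hd ht (Sum.inr (Sum.inl i)))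
    (jetKernel_gaussBounded hd ht (Sum.inr (Sum.inr (i, i))))
    (fun x => jetKernel_hasLineDerivAt hd ht x i i) hf
  have := integral_bilinear_hasLineDerivAt_right_eq_neg_left_of_integrable
    (μ := (volume : Measure Plane)) (B := ContinuousLinearMap.mul ℝ ℝ)
    ((m (Sum.inr (Sum.inl i))).integrable_mul (m (Sum.inr (Sum.inl i))))
    ((m (Sum.inl ())).integrable_mul (m (Sum.inr (Sum.inr (i, i)))))
    ((m (Sum.inl ())).integrable_mul (m (Sum.inr (Sum.inl i))))
    (fun x _ => l1 x) (fun x _ => l2 x)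
  simp only [ContinuousLinearMap.mul_apply', ← sq] at this
  exact this

/-- The squared `L²(ℝ²)`-norm of the convolution of `f` with a jet kernel. -/
def jetEnergy (d : ℝ) (f : Plane → ℝ) (κ : JetIndex) (t : ℝ) : ℝ :=
  ∫ x, gconv (jetKernel d κ t) f x ^ 2

theorem jetEnergy_nonneg (d : ℝ) (f : Plane → ℝ) (κ : JetIndex) (t : ℝ) :
    0 ≤ jetEnergy d f κ t := integral_nonneg fun _ => sq_nonneg _

theorem jetEnergy_eq {d t : ℝ} (hd : 0 < d) (ht : 0 < t) {f : Plane → ℝ}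
    (hf : MemLp f 2) (κ : JetIndex) :
    jetEnergy d f κ t = ‖lpOf (volume.restrict univ) (gconv (jetKernel d κ t) f)‖ ^ 2 := by
  rw [lpOf_norm_sq (gconv_memLp hd ht (jetKernel_mem d κ) hf univ), Measure.restrict_univ]
  rfl

theorem jetEnergy_continuousOn {d : ℝ} (hd : 0 < d) {f : Plane → ℝ} (hf : MemLp f 2)
    (κ : JetIndex) : ContinuousOn (jetEnergy d f κ) (Ioi 0) :=
  ((lpOf_gconv_continuousOn hd (jetKernel_mem d κ) hf univ).norm.pow 2).congr
    fun _ ht => jetEnergy_eq hd ht hf κ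

/-- The energy identity `d/dt ‖u‖² = -2d ‖∇u‖²` for `u = G_t * f`. -/
theorem jetEnergy_hasDerivAt {d : ℝ} (hd : 0 < d) {f : Plane → ℝ} (hf : MemLp f 2)
    {t : ℝ} (ht : 0 < t) :
    HasDerivAt (jetEnergy d f (Sum.inl ()))
      (-(2 * d * ∑ i : Fin 2, jetEnergy d f (Sum.inr (Sum.inl i)) t)) t := by
  have h := (lpOf_heat_hasDerivAt hd hf univ ht).norm_sq
  refine (h.congr_of_eventuallyEq ?_).congr_deriv ?_
  · filter_upwards [Ioi_mem_nhds ht] with s hs using jetEnergy_eq hd hs hf (Sum.inl ())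
  · rw [inner_smul_right, inner_sum]
    have e (i : Fin 2) : inner ℝ (lpOf (volume.restrict univ) (gconv (heatKernel d t) f))
        (lpOf (volume.restrict univ) (gconv (jetKernel d (Sum.inr (Sum.inr (i, i))) t) f)) =
        -jetEnergy d f (Sum.inr (Sum.inl i)) t := by
      rw [lpOf_inner (f := gconv (heatKernel d t) f) (gconv_memLp hd ht (jetKernel_mem d (Sum.inl ())) hf univ)
        (gconv_memLp hd ht (jetKernel_mem d _) hf univ), Measure.restrict_univ]
      exact integral_gconv_mul_second hd ht hf i
    simp only [e, Finset.sum_neg_distrib]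
    ring

/-- The gradient of `G_t * f` is square integrable in space-time. -/
theorem jetEnergy_first_integrableOn {d T : ℝ} (hd : 0 < d) (hT : 0 < T) {f : Plane → ℝ}
    (hf : MemLp f 2) (i : Fin 2) :
    IntegrableOn (jetEnergy d f (Sum.inr (Sum.inl i))) (Ioc 0 T) := by
  have hlim : Filter.Tendsto (fun n : ℕ => T / ((n : ℝ) + 1)) Filter.atTop (nhds 0) := by
    have := (tendsto_one_div_add_atTop_nhds_zero_nat (𝕜 := ℝ)).const_mul T
    simpa [div_eq_mul_inv] using this
  have hpos (n : ℕ) : 0 < T / ((n : ℝ) + 1) := by positivity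
  have hle (n : ℕ) : T / ((n : ℝ) + 1) ≤ T := div_le_self hT.le (by
    have : (0 : ℝ) ≤ n := n.cast_nonneg
    linarith)
  have hc (n : ℕ) (j : Fin 2) :
      ContinuousOn (jetEnergy d f (Sum.inr (Sum.inl j))) (Icc (T / ((n : ℝ) + 1)) T) :=
    (jetEnergy_continuousOn hd hf _).mono fun t ht => (hpos n).trans_le ht.1
  refine integrableOn_Ioc_of_intervalIntegral_norm_bounded_left
    (I := (2 * d)⁻¹ * ∫ x, f x ^ 2) (a := fun n : ℕ => T / ((n : ℝ) + 1))
    (fun n => ((hc n i).integrableOn_Icc).mono_set Ioc_subset_Icc_self) hlim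
    (.of_forall fun n => ?_)
  have hcs : ContinuousOn
      (fun t => -(2 * d * ∑ i : Fin 2, jetEnergy d f (Sum.inr (Sum.inl i)) t))
      (Icc (T / ((n : ℝ) + 1)) T) :=
    ((continuousOn_finsetSum _ fun j _ => hc n j).const_mul (2 * d)).neg
  have hftc := intervalIntegral.integral_eq_sub_of_hasDerivAt
    (a := T / ((n : ℝ) + 1)) (b := T) (f := jetEnergy d f (Sum.inl ()))
    (fun t ht => jetEnergy_hasDerivAt hd hf
      ((hpos n).trans_le (by rw [uIcc_of_le (hle n)] at ht; exact ht.1)))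
    (ContinuousOn.intervalIntegrable (by rwa [uIcc_of_le (hle n)]))
  rw [intervalIntegral.integral_neg, intervalIntegral.integral_const_mul,
    intervalIntegral.integral_of_le (hle n)] at hftc
  have h1 : ∫ t in Ioc (T / ((n : ℝ) + 1)) T, ‖jetEnergy d f (Sum.inr (Sum.inl i)) t‖ ≤
      ∫ t in Ioc (T / ((n : ℝ) + 1)) T, ∑ j : Fin 2, jetEnergy d f (Sum.inr (Sum.inl j)) t := by
    refine setIntegral_mono_on ((hc n i).integrableOn_Icc.mono_set Ioc_subset_Icc_self).norm
      (((continuousOn_finsetSum _ fun j _ => hc n j).integrableOn_Icc).mono_set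
        Ioc_subset_Icc_self) measurableSet_Ioc fun t _ => ?_
    rw [Real.norm_eq_abs, abs_of_nonneg (jetEnergy_nonneg ..)]
    exact Finset.single_le_sum (f := fun j => jetEnergy d f (Sum.inr (Sum.inl j)) t)
      (fun j _ => jetEnergy_nonneg ..) (Finset.mem_univ i)
  have h2 : jetEnergy d f (Sum.inl ()) (T / ((n : ℝ) + 1)) ≤ ∫ x, f x ^ 2 :=
    integral_sq_gconv_heatKernel_le hd (hpos n) hf
  have h3 := jetEnergy_nonneg d f (Sum.inl ()) T
  refine h1.trans ?_
  rw [inv_mul_eq_div, le_div_iff₀ (by positivity)]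
  linarith

theorem jetEnergy_bounded_integrableOn {d T : ℝ} (hd : 0 < d) {f : Plane → ℝ}
    (hf : MemLp f 2) (κ : JetIndex) {M : ℝ} (h : ∀ t, 0 < t → jetEnergy d f κ t ≤ M) :
    IntegrableOn (jetEnergy d f κ) (Ioc 0 T) := by
  refine ⟨((jetEnergy_continuousOn hd hf κ).mono Ioc_subset_Ioi_self).aestronglyMeasurable
    measurableSet_Ioc, .restrict_of_bounded (C := M) measure_Ioc_lt_top ?_⟩
  filter_upwards [ae_restrict_mem measurableSet_Ioc] with t ht
  rw [Real.norm_eq_abs, abs_of_nonneg (jetEnergy_nonneg ..)]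
  exact h t ht.1

theorem jetKernel_symm (d t : ℝ) (i j : Fin 2) :
    jetKernel d (Sum.inr (Sum.inr (i, j))) t = jetKernel d (Sum.inr (Sum.inr (j, i))) t := by
  ext x
  simp only [jetKernel, mul_comm (x i), eq_comm (a := i)]

/-- For initial data in `H¹(ℝ²)` the whole second order jet of the heat flow is square integrable
in space-time: a derivative is moved onto the initial datum, the gradient of the heat flow of which
is square integrable in space-time. -/
theorem jetEnergy_integrableOn {d T : ℝ} (hd : 0 < d) (hT : 0 < T) {f : Plane → ℝ}
    (hf : MemH1 univ f) (κ : JetIndex) : IntegrableOn (jetEnergy d f κ) (Ioc 0 T) := by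
  obtain ⟨m, hD⟩ := hf
  rw [Measure.restrict_univ] at m hD
  have key (i : Fin 2) : ∃ g : Plane → ℝ, MemLp g 2 ∧
      (∀ t, 0 < t → jetEnergy d f (Sum.inr (Sum.inl i)) t = jetEnergy d g (Sum.inl ()) t) ∧
      ∀ j t, 0 < t → jetEnergy d f (Sum.inr (Sum.inr (i, j))) t =
        jetEnergy d g (Sum.inr (Sum.inl j)) t := by
    obtain ⟨g, hg, hw⟩ := hD (unitVec i)
    refine ⟨g, hg, fun t ht => ?_, fun j t ht => ?_⟩
    · refine integral_congr_ae (.of_forall fun x => ?_)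
      simp only
      rw [gconv_weakDeriv (K := jetKernel d (Sum.inl ()) t) (jetKernel_gaussBounded hd ht _)
        (jetKernel_gaussBounded hd ht _) (gaussKernels_contDiff (jetKernel_mem d _) t)
        (fun x => heatKernel_hasLineDerivAt hd ht x i) m hg hw]
    · refine integral_congr_ae (.of_forall fun x => ?_)
      simp only
      -- The weak derivative of `f` is in direction `i`, so `∂ᵢ` has to be the outer derivative.
      rw [jetKernel_symm, gconv_weakDeriv (jetKernel_gaussBounded hd ht _)
        (jetKernel_gaussBounded hd ht _) (gaussKernels_contDiff (jetKernel_mem d _) t)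
        (fun x => jetKernel_hasLineDerivAt hd ht x j i) m hg hw]
  match κ with
  | Sum.inl () =>
    exact jetEnergy_bounded_integrableOn hd m _ fun t ht =>
      integral_sq_gconv_heatKernel_le hd ht m
  | Sum.inr (Sum.inl i) =>
    obtain ⟨g, hg, h1, -⟩ := key i
    exact jetEnergy_bounded_integrableOn hd m _ fun t ht =>
      (h1 t ht).trans_le (integral_sq_gconv_heatKernel_le hd ht hg)
  | Sum.inr (Sum.inr (i, j)) =>
    obtain ⟨g, hg, -, h2⟩ := key i
    exact (jetEnergy_first_integrableOn hd hT hg j).congr_fun (fun t ht => (h2 j t ht.1).symm)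
      measurableSet_Ioc

/-- The `H²(U)`-valued heat flow with initial datum `f`. -/
def heatFlow (d : ℝ) (f : Plane → ℝ) (U : Set Plane) (t : ℝ) : H2Space U :=
  mkH2 U fun κ => gconv (jetKernel d κ t) f

theorem heatFlow_continuousOn {d : ℝ} (hd : 0 < d) {f : Plane → ℝ} (hf : MemLp f 2)
    (U : Set Plane) : ContinuousOn (heatFlow d f U) (Ioi 0) :=
  continuousOn_mkH2 (fun _ ht => isJet_gconv hd ht hf U)
    fun κ => lpOf_gconv_continuousOn hd (jetKernel_mem d κ) hf U

theorem heatFlow_hasDerivAt {d : ℝ} (hd : 0 < d) {f : Plane → ℝ} (hf : MemLp f 2)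
    (U : Set Plane) {t : ℝ} (ht : 0 < t) :
    HasDerivAt (fun t => H2Space.toL2 (heatFlow d f U t))
      (d • H2Space.laplacian (heatFlow d f U t)) t := by
  rw [heatFlow, (isJet_gconv hd ht hf U).laplacian_mkH2]
  refine (lpOf_heat_hasDerivAt hd hf U ht).congr_of_eventuallyEq ?_
  filter_upwards [Ioi_mem_nhds ht] with s hs
  exact (isJet_gconv hd hs hf U).toL2_mkH2

theorem heatFlow_memLp {d T : ℝ} (hd : 0 < d) (hT : 0 < T) {f : Plane → ℝ}
    (hf : MemH1 univ f) (U : Set Plane) :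
    MemLp (heatFlow d f U) 2 (volume.restrict (Ioo 0 T)) := by
  have m : MemLp f 2 := by simpa using hf.1
  have hm : AEStronglyMeasurable (heatFlow d f U) (volume.restrict (Ioo 0 T)) :=
    ((heatFlow_continuousOn hd m U).mono Ioo_subset_Ioi_self).aestronglyMeasurable
      measurableSet_Ioo
  rw [memLp_two_iff_integrable_sq_norm hm]
  have hi : IntegrableOn (fun t => ∑ κ, jetEnergy d f κ t) (Ioo 0 T) :=
    integrable_finsetSum _ fun κ _ =>
      (jetEnergy_integrableOn hd hT hf κ).mono_set Ioo_subset_Ioc_self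
  refine hi.mono' (hm.norm.pow 2) ?_
  filter_upwards [ae_restrict_mem measurableSet_Ioo] with t ht
  rw [Real.norm_eq_abs, abs_of_nonneg (sq_nonneg _), H2Space.norm_sq_eq]
  refine Finset.sum_le_sum fun κ _ => ?_
  have hk := ((jetKernel_gaussBounded hd ht.1 κ).young m).1
  rw [heatFlow, (isJet_gconv hd ht.1 m U).component_mkH2, lpOf_norm_sq (hk.restrict U)]
  exact setIntegral_le_integral ((memLp_two_iff_integrable_sq hk.1).1 hk)
    (.of_forall fun x => sq_nonneg _)

/-! ### The Duhamel integral of a point source -/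

/-- Away from `x = 0` a Gaussian kernel is Lipschitz in time up to `t = 0`, where it vanishes. -/
theorem gaussKernels_lipschitz_of_norm_ge {d T ρ : ℝ} (hd : 0 < d) (hT : 0 < T) (hρ : 0 < ρ)
    {K : ℝ → Plane → ℝ} (hK : K ∈ gaussKernels d) :
    ∃ B : Plane → ℝ, MemLp B 2 ∧
      (∀ t ∈ Ioc 0 T, ∀ x, ρ ≤ ‖x‖ ^ 2 → |K t x| ≤ t * B x) ∧
      ∀ s ∈ Ioc 0 T, ∀ t ∈ Ioc 0 T, ∀ x, ρ ≤ ‖x‖ ^ 2 → |K s x - K t x| ≤ |s - t| * B x := by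
  obtain ⟨K', hK', h⟩ := gaussKernels_hasDerivAt hd hK
  obtain ⟨C, hC, hb⟩ := gaussKernels_bound hd hT hρ hK
  obtain ⟨C', hC', hb'⟩ := gaussKernels_bound hd hT hρ hK'
  have hc : 0 < (8 * d * T)⁻¹ := by positivity
  refine ⟨fun x => (C + C' * T) * gaussMajorant (8 * d * T)⁻¹ x,
    (gaussMajorant_memLp hc).const_mul _, fun t ht x hx => ?_, fun s hs t ht x hx => ?_⟩
  · refine (hb t ht.1 ht.2 x (.inr hx)).trans ?_
    have ht0 := ht.1
    rw [mul_comm C t, mul_assoc]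
    refine mul_le_mul_of_nonneg_left ?_ ht.1.le
    refine mul_le_mul_of_nonneg_right ?_ (gaussMajorant_pos _ x).le
    exact le_add_of_nonneg_right (by positivity)
  · have := (convex_Ioc 0 T).norm_image_sub_le_of_norm_hasDerivWithin_le
      (f := fun r => K r x) (f' := fun r => K' r x)
      (C := (C + C' * T) * gaussMajorant (8 * d * T)⁻¹ x)
      (fun r hr => (h r hr.1 x).hasDerivWithinAt) (fun r hr => ?_) ht hs
    · rw [mul_comm]
      exact this
    · refine (hb' r hr.1 hr.2 x (.inr hx)).trans ?_
      refine mul_le_mul_of_nonneg_right ?_ (gaussMajorant_pos _ x).le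
      have : C' * r ≤ C' * T := mul_le_mul_of_nonneg_left hr.2 hC'
      linarith

/-- The heat kernel as a curve in `H²(U)`, extended by zero to nonpositive times. -/
def kernelCurve (d : ℝ) (U : Set Plane) (t : ℝ) : H2Space U :=
  if 0 < t then mkH2 U fun κ => jetKernel d κ t else 0

section KernelCurve

variable {d ρ : ℝ} {U : Set Plane}

theorem kernelCurve_of_pos {t : ℝ} (ht : 0 < t) :
    kernelCurve d U t = mkH2 U fun κ => jetKernel d κ t := if_pos ht

theorem kernelCurve_of_nonpos {t : ℝ} (ht : t ≤ 0) : kernelCurve d U t = 0 :=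
  if_neg ht.not_gt

/-- The bound tends to zero as `t → 0`, which makes the extension by zero continuous. -/
theorem kernelCurve_norm_le (hd : 0 < d) (hρ : 0 < ρ) (hU : MeasurableSet U)
    (hUρ : ∀ x ∈ U, ρ ≤ ‖x‖ ^ 2) {T : ℝ} (hT : 0 < T) :
    ∃ C, 0 ≤ C ∧ ∀ t ≤ T, ‖kernelCurve d U t‖ ≤ C * max t 0 := by
  -- A common majorant for all components of the jet is the sum of their `L²` majorants.
  choose B hB h1 _ using fun κ => gaussKernels_lipschitz_of_norm_ge hd hT hρ (jetKernel_mem d κ)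
  set S := ∑ κ, ‖lpOf (volume.restrict U) (B κ)‖
  have hS : 0 ≤ S := Finset.sum_nonneg fun _ _ => norm_nonneg _
  refine ⟨Fintype.card JetIndex * S, by positivity, fun t htT => ?_⟩
  rcases le_or_gt t 0 with ht | ht
  · rw [kernelCurve_of_nonpos ht, norm_zero]
    positivity
  · rw [kernelCurve_of_pos ht, max_eq_left ht.le, mul_assoc]
    refine H2Space.norm_le _ fun κ => ?_
    rw [(isJet_jetKernel hd ht U).component_mkH2, mul_comm]
    refine (lpOf_norm_le ((isJet_jetKernel hd ht U).memLp κ) ((hB κ).restrict U) ht.le ?_).trans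
      (mul_le_mul_of_nonneg_left ?_ ht.le)
    · filter_upwards [ae_restrict_mem hU] with x hx using h1 κ t ⟨ht, htT⟩ x (hUρ x hx)
    · exact Finset.single_le_sum (f := fun κ => ‖lpOf (volume.restrict U) (B κ)‖)
        (fun _ _ => norm_nonneg _) (Finset.mem_univ κ)

theorem kernelCurve_continuous (hd : 0 < d) (hρ : 0 < ρ) (hU : MeasurableSet U)
    (hUρ : ∀ x ∈ U, ρ ≤ ‖x‖ ^ 2) : Continuous (kernelCurve d U) := by
  rw [continuous_iff_continuousAt]
  intro t
  rcases lt_trichotomy t 0 with ht | rfl | ht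
  · refine (continuousAt_const (y := (0 : H2Space U))).congr ?_
    filter_upwards [Iio_mem_nhds ht] with s hs
    exact (kernelCurve_of_nonpos (le_of_lt hs)).symm
  · obtain ⟨C, -, h⟩ := kernelCurve_norm_le hd hρ hU hUρ one_pos
    rw [ContinuousAt, kernelCurve_of_nonpos le_rfl]
    refine squeeze_zero_norm' (a := fun t : ℝ => C * max t 0) ?_ ?_
    · filter_upwards [Iic_mem_nhds one_pos] with s hs using h s hs
    · have : Filter.Tendsto (fun t : ℝ => C * max t 0) (nhds 0) (nhds (C * max 0 0)) :=
        Continuous.tendsto (by fun_prop) 0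
      simpa using this
  · have hc : ContinuousOn (fun t => mkH2 U fun κ => jetKernel d κ t) (Ioi 0) := by
      refine continuousOn_mkH2 (fun _ ht => isJet_jetKernel hd ht U) fun κ t (ht : 0 < t) => ?_
      obtain ⟨B, hB, -, hl⟩ := gaussKernels_lipschitz_of_norm_ge (T := 2 * t) hd (by positivity) hρ
        (jetKernel_mem d κ)
      refine ContinuousAt.continuousWithinAt ?_
      rw [ContinuousAt, tendsto_iff_norm_sub_tendsto_zero]
      refine squeeze_zero' (g := fun s => |s - t| * ‖lpOf (volume.restrict U) B‖)
        (.of_forall fun _ => norm_nonneg _) ?_ ?_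
      · filter_upwards [Ioc_mem_nhds ht (show t < 2 * t by linarith)] with s hs
        refine lpOf_lipschitz (h := fun s => jetKernel d κ s)
          ((isJet_jetKernel hd hs.1 U).memLp κ) ((isJet_jetKernel hd ht U).memLp κ)
          (hB.restrict U) ?_
        filter_upwards [ae_restrict_mem hU] with x hx
        exact hl s hs t ⟨ht, by linarith⟩ x (hUρ x hx)
      · have : Filter.Tendsto (fun s => |s - t| * ‖lpOf (volume.restrict U) B‖) (nhds t)
            (nhds (|t - t| * ‖lpOf (volume.restrict U) B‖)) :=
          Continuous.tendsto (by fun_prop) t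
        simpa using this
    refine (hc.continuousAt (Ioi_mem_nhds ht)).congr ?_
    filter_upwards [Ioi_mem_nhds ht] with s hs
    exact (kernelCurve_of_pos hs).symm

/-- Away from the source the heat kernel, extended by zero, is a `C¹` curve in `L²(U)` on the whole
time axis. -/
theorem kernelCurve_hasDerivAt (hd : 0 < d) (hρ : 0 < ρ) (hU : MeasurableSet U)
    (hUρ : ∀ x ∈ U, ρ ≤ ‖x‖ ^ 2) (t : ℝ) :
    HasDerivAt (fun t => H2Space.component U (Sum.inl ()) (kernelCurve d U t))
      ((d • H2Space.laplacianCLM U) (kernelCurve d U t)) t := by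
  have hc := kernelCurve_continuous hd hρ hU hUρ
  have hne : ∀ t ≠ 0, HasDerivAt (fun t => H2Space.component U (Sum.inl ()) (kernelCurve d U t))
      ((d • H2Space.laplacianCLM U) (kernelCurve d U t)) t := by
    intro t ht
    rcases ht.lt_or_gt with ht | ht
    · rw [kernelCurve_of_nonpos ht.le, map_zero]
      refine (hasDerivAt_const t (0 : L2Space U)).congr_of_eventuallyEq ?_
      filter_upwards [Iio_mem_nhds ht] with s hs
      rw [kernelCurve_of_nonpos (le_of_lt hs), map_zero]
    · obtain ⟨B, hB, -, hl⟩ := gaussKernels_lipschitz_of_norm_ge (T := 2 * t) hd (by positivity) hρ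
        (heatKernelDeriv_mem d)
      have m {K : ℝ → Plane → ℝ} (hK : K ∈ gaussKernels d) {s : ℝ} (hs : 0 < s) :
          MemLp (K s) 2 (volume.restrict U) :=
        (gaussKernels_gaussBounded hd hs hK).memLp.restrict U
      have key := lpOf_hasDerivAt (μ := volume.restrict U) (a := 0) (b := 2 * t)
        (h := heatKernel d) (h' := heatKernelDeriv d)
        (fun s hs => m (jetKernel_mem d (Sum.inl ())) hs.1)
        (fun s hs => m (heatKernelDeriv_mem d) hs.1) (hB.restrict U)
        (.of_forall fun x s hs => heatKernel_hasDerivAt' hd hs.1 x)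
        (by
          filter_upwards [ae_restrict_mem hU] with x hx s hs r hr
          exact hl s (Ioo_subset_Ioc_self hs) r (Ioo_subset_Ioc_self hr) x (hUρ x hx))
        (t := t) ⟨ht, by linarith⟩
      have e : heatKernelDeriv d t = fun x => d * (jetKernel d (Sum.inr (Sum.inr (0, 0))) t x +
          jetKernel d (Sum.inr (Sum.inr (1, 1))) t x) := by
        ext x
        exact heatKernelDeriv_apply d t x
      rw [e, lpOf_lincomb (h := fun i => jetKernel d (Sum.inr (Sum.inr (i, i))) t)
        (fun i => m (jetKernel_mem d _) ht)] at key
      rw [kernelCurve_of_pos ht, smul_apply, H2Space.laplacianCLM_apply,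
        (isJet_jetKernel hd ht U).laplacian_mkH2]
      refine key.congr_of_eventuallyEq ?_
      filter_upwards [Ioi_mem_nhds ht] with s hs
      rw [kernelCurve_of_pos hs]
      exact (isJet_jetKernel hd hs U).component_mkH2 _
  -- At `t = 0` the derivative exists because the curve and its derivative extend continuously.
  rcases eq_or_ne t 0 with rfl | ht
  · exact hasDerivAt_of_hasDerivAt_of_ne hne
      ((H2Space.component U _).continuous.comp hc).continuousAt
      ((d • H2Space.laplacianCLM U).continuous.comp hc).continuousAt
  · exact hne t ht

end KernelCurve

/-- The `H²(U)`-valued Duhamel integral of the source `φ δ₀` acting during `(0, T)`. -/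
def duhamel (d T : ℝ) (φ : ℝ → ℝ) (U : Set Plane) (t : ℝ) : H2Space U :=
  ∫ s in Ioo 0 T, φ s • kernelCurve d U (t - s)

section Duhamel

variable {d T ρ : ℝ} {U : Set Plane} {φ : ℝ → ℝ}

theorem smul_kernelCurve_integrable (hd : 0 < d) (hρ : 0 < ρ) (hU : MeasurableSet U)
    (hUρ : ∀ x ∈ U, ρ ≤ ‖x‖ ^ 2) (hT : 0 < T) (hφ : IntegrableOn φ (Ioo 0 T)) {t : ℝ}
    (ht : t ≤ T) : IntegrableOn (fun s => φ s • kernelCurve d U (t - s)) (Ioo 0 T) := by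
  obtain ⟨C, hC, hb⟩ := kernelCurve_norm_le hd hρ hU hUρ hT
  have hc := kernelCurve_continuous hd hρ hU hUρ
  refine (hφ.norm.mul_const (C * T)).mono'
    (hφ.1.smul (hc.comp (continuous_const.sub continuous_id)).aestronglyMeasurable) ?_
  filter_upwards [ae_restrict_mem measurableSet_Ioo] with s hs
  rw [norm_smul]
  gcongr
  have hs0 := hs.1
  refine (hb _ (by linarith)).trans ?_
  gcongr
  exact max_le (by linarith) hT.le

theorem duhamel_continuousOn (hd : 0 < d) (hρ : 0 < ρ) (hU : MeasurableSet U)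
    (hUρ : ∀ x ∈ U, ρ ≤ ‖x‖ ^ 2) (hT : 0 < T) (hφ : IntegrableOn φ (Ioo 0 T)) :
    ContinuousOn (duhamel d T φ U) (Iic T) ∧
      ∃ M, ∀ t ≤ T, ‖duhamel d T φ U t‖ ≤ M := by
  obtain ⟨C, hC, hb⟩ := kernelCurve_norm_le hd hρ hU hUρ hT
  have hc := kernelCurve_continuous hd hρ hU hUρ
  have hbd : ∀ t ≤ T, ∀ᵐ s ∂volume.restrict (Ioo 0 T),
      ‖φ s • kernelCurve d U (t - s)‖ ≤ ‖φ s‖ * (C * T) := by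
    intro t ht
    filter_upwards [ae_restrict_mem measurableSet_Ioo] with s hs
    rw [norm_smul]
    gcongr
    have hs0 := hs.1
    refine (hb _ (by linarith)).trans ?_
    gcongr
    exact max_le (by linarith) hT.le
  refine ⟨continuousOn_of_dominated (bound := fun s => ‖φ s‖ * (C * T))
    (fun t ht => (smul_kernelCurve_integrable hd hρ hU hUρ hT hφ ht).1) hbd
    (hφ.norm.mul_const _) (.of_forall fun s => ?_),
    ∫ s in Ioo 0 T, ‖φ s‖ * (C * T), fun t ht =>
    norm_integral_le_of_norm_le (hφ.norm.mul_const _) (hbd t ht)⟩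
  exact ((hc.comp (continuous_id.sub continuous_const)).const_smul (φ s)).continuousOn

theorem duhamel_memLp (hd : 0 < d) (hρ : 0 < ρ) (hU : MeasurableSet U)
    (hUρ : ∀ x ∈ U, ρ ≤ ‖x‖ ^ 2) (hT : 0 < T) (hφ : IntegrableOn φ (Ioo 0 T)) :
    MemLp (duhamel d T φ U) 2 (volume.restrict (Ioo 0 T)) := by
  obtain ⟨hc, M, hM⟩ := duhamel_continuousOn hd hρ hU hUρ hT hφ
  refine MemLp.of_bound ((hc.mono fun t ht => ht.2.le).aestronglyMeasurable measurableSet_Ioo) M ?_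
  filter_upwards [ae_restrict_mem measurableSet_Ioo] with t ht using hM t ht.2.le

theorem duhamel_hasDerivAt (hd : 0 < d) (hρ : 0 < ρ) (hU : MeasurableSet U)
    (hUρ : ∀ x ∈ U, ρ ≤ ‖x‖ ^ 2) (hT : 0 < T) (hφ : IntegrableOn φ (Ioo 0 T)) {t : ℝ}
    (ht : t ∈ Ioo 0 T) :
    HasDerivAt (fun t => H2Space.toL2 (duhamel d T φ U t))
      (d • H2Space.laplacian (duhamel d T φ U t)) t := by
  obtain ⟨C, hC, hb⟩ := kernelCurve_norm_le hd hρ hU hUρ hT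
  have hint := fun t ht => smul_kernelCurve_integrable hd hρ hU hUρ hT hφ (t := t) ht
  set L : H2Space U →L[ℝ] L2Space U := d • H2Space.laplacianCLM U with hL
  set P := H2Space.component U (Sum.inl ()) with hP
  have hcomm (A : H2Space U →L[ℝ] L2Space U) {t : ℝ} (ht : t ≤ T) :
      ∫ s in Ioo 0 T, φ s • A (kernelCurve d U (t - s)) = A (duhamel d T φ U t) := by
    rw [duhamel, ← A.integral_comp_comm (hint t ht)]
    simp only [map_smul]
  have hi (A : H2Space U →L[ℝ] L2Space U) {t : ℝ} (ht : t ≤ T) :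
      IntegrableOn (fun s => φ s • A (kernelCurve d U (t - s))) (Ioo 0 T) := by
    have := A.integrable_comp (hint t ht)
    simp only [map_smul] at this
    exact this
  have key := (hasDerivAt_integral_of_dominated_loc_of_deriv_le (x₀ := t)
    (μ := volume.restrict (Ioo 0 T))
    (F := fun t s => φ s • P (kernelCurve d U (t - s)))
    (F' := fun t s => φ s • L (kernelCurve d U (t - s)))
    (bound := fun s => ‖φ s‖ * (‖L‖ * (C * T))) (s := Iic T) (Iic_mem_nhds ht.2)
    (by filter_upwards [Iic_mem_nhds ht.2] with r hr using (hi P hr).1)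
    (hi P ht.2.le) (hi L ht.2.le).1 (by
      filter_upwards [ae_restrict_mem measurableSet_Ioo] with s hs r hr
      rw [norm_smul]
      gcongr
      refine (L.le_opNorm _).trans ?_
      gcongr
      have hs0 := hs.1
      have hr' : r ≤ T := hr
      refine (hb _ (by linarith)).trans ?_
      gcongr
      exact max_le (by linarith) hT.le)
    (hφ.norm.mul_const _) (.of_forall fun s r _ => by
      have := (kernelCurve_hasDerivAt hd hρ hU hUρ (r - s)).comp_sub_const r s
      exact this.const_smul (φ s))).2
  rw [hcomm L ht.2.le, hL, smul_apply, H2Space.laplacianCLM_apply] at key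
  refine key.congr_of_eventuallyEq ?_
  filter_upwards [Iic_mem_nhds ht.2] with r hr
  exact (hcomm P hr).symm

/-- A Bochner integral in `L²` may be evaluated pointwise. -/
theorem coeFn_integral_Lp {α β : Type*} [MeasurableSpace α] [MeasurableSpace β] {μ : Measure α}
    {ν : Measure β} [SigmaFinite μ] [SFinite ν] {Φ : β → Lp ℝ 2 μ} {q : β → α → ℝ}
    (hΦ : Integrable Φ ν) (hq : Integrable (fun p : β × α => q p.1 p.2) (ν.prod μ))
    (h : ∀ᵐ s ∂ν, Φ s =ᵐ[μ] q s) : ⇑(∫ s, Φ s ∂ν) =ᵐ[μ] fun x => ∫ s, q s x ∂ν := by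
  have hqi : Integrable (fun x => ∫ s, q s x ∂ν) μ := hq.integral_prod_right
  refine ae_eq_of_forall_setIntegral_eq_of_sigmaFinite (fun A hA hμA => ?_)
    (fun A _ _ => hqi.integrableOn) (fun A hA hμA => ?_)
  · have : IsFiniteMeasure (μ.restrict A) := ⟨by rwa [Measure.restrict_apply_univ]⟩
    exact ((Lp.memLp _).restrict A).integrable (by norm_num)
  · rw [← L2.inner_indicatorConstLp_one hA hμA.ne, ← integral_inner hΦ]
    have hq' : Integrable (fun p : β × α => q p.1 p.2) (ν.prod (μ.restrict A)) := by
      have := hq.integrableOn (s := univ ×ˢ A)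
      rwa [IntegrableOn, ← Measure.prod_restrict, Measure.restrict_univ] at this
    rw [← integral_integral_swap hq']
    refine integral_congr_ae ?_
    filter_upwards [h] with s hs
    rw [L2.inner_indicatorConstLp_one hA hμA.ne]
    exact integral_congr_ae (ae_restrict_of_ae hs)

theorem heatKernel_duhamel_intervalIntegrable (hd : 0 < d) (hρ : 0 < ρ) (hT : 0 < T)
    (hφ : IntegrableOn φ (Ioo 0 T)) {t : ℝ} (ht : t ∈ Ioc 0 T) {x : Plane} (hx : ρ ≤ ‖x‖ ^ 2) :
    IntervalIntegrable (fun s => heatKernel d (t - s) x * φ s) volume 0 t := by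
  obtain ⟨B, -, hb, -⟩ := gaussKernels_lipschitz_of_norm_ge hd hT hρ (jetKernel_mem d (Sum.inl ()))
  rw [intervalIntegrable_iff_integrableOn_Ioo_of_le ht.1.le]
  have hm : Measurable fun s => heatKernel d (t - s) x := by
    unfold heatKernel
    fun_prop
  refine (hφ.mono_set (Ioo_subset_Ioo_right ht.2)).bdd_mul (c := T * |B x|)
    hm.aestronglyMeasurable ?_
  filter_upwards [ae_restrict_mem measurableSet_Ioo] with s hs
  have h0 := hs.1
  have h1 : 0 < t - s := sub_pos.2 hs.2
  have h2 : t - s ≤ T := by linarith [ht.2]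
  refine (hb (t - s) ⟨h1, h2⟩ x hx).trans ?_
  exact mul_le_mul h2 (le_abs_self _) (le_of_mul_le_mul_left (by
    simpa using (abs_nonneg _).trans (hb (t - s) ⟨h1, h2⟩ x hx)) h1) hT.le

/-- The `H²(U)`-valued Duhamel integral represents the pointwise Duhamel integral. -/
theorem coeFn_duhamel (hd : 0 < d) (hρ : 0 < ρ) (hU : MeasurableSet U)
    (hUρ : ∀ x ∈ U, ρ ≤ ‖x‖ ^ 2) (hT : 0 < T) (hφ : IntegrableOn φ (Ioo 0 T)) {t : ℝ}
    (ht : t ∈ Ioc 0 T) :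
    H2Space.toL2 (duhamel d T φ U t) =ᵐ[volume.restrict U]
      fun x => ∫ s in (0 : ℝ)..t, heatKernel d (t - s) x * φ s := by
  have hint := smul_kernelCurve_integrable hd hρ hU hUρ hT hφ ht.2
  set P := H2Space.component U (Sum.inl ()) with hP
  have e : H2Space.toL2 (duhamel d T φ U t) =
      ∫ s in Ioo 0 T, P (φ s • kernelCurve d U (t - s)) :=
    (P.integral_comp_comm hint).symm
  obtain ⟨C, hC, hb⟩ := gaussKernels_bound hd hT hρ (jetKernel_mem d (Sum.inl ()))
  have hc : 0 < (8 * d * T)⁻¹ := by positivity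
  have hq : Integrable (fun p : ℝ × Plane =>
      (Iio t).indicator (fun s => heatKernel d (t - s) p.2 * φ s) p.1)
      ((volume.restrict (Ioo 0 T)).prod (volume.restrict U)) := by
    have hm : Measurable fun p : ℝ × Plane => heatKernel d (t - p.1) p.2 := by
      unfold heatKernel
      fun_prop
    have hm' : AEStronglyMeasurable (fun p : ℝ × Plane =>
        (Iio t).indicator (fun s => heatKernel d (t - s) p.2 * φ s) p.1)
        ((volume.restrict (Ioo 0 T)).prod (volume.restrict U)) := by
      have : (fun p : ℝ × Plane =>
          (Iio t).indicator (fun s => heatKernel d (t - s) p.2 * φ s) p.1) =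
          (Prod.fst ⁻¹' Iio t).indicator
            fun p : ℝ × Plane => heatKernel d (t - p.1) p.2 * φ p.1 := by
        ext p
        simp only [indicator, mem_preimage]
      rw [this]
      exact (hm.aestronglyMeasurable.mul hφ.1.comp_fst).indicator
        (measurable_fst measurableSet_Iio)
    refine ((hφ.norm.mul_prod ((gaussMajorant_integrable hc).restrict (s := U))).const_mul
      (C * T)).mono' hm' ?_
    have h1 : ∀ᵐ p ∂((volume.restrict (Ioo 0 T)).prod (volume.restrict U)),
        p ∈ Ioo (0 : ℝ) T ×ˢ U := by
      rw [Measure.prod_restrict]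
      exact ae_restrict_mem (measurableSet_Ioo.prod hU)
    filter_upwards [h1] with p hp
    have hs0 : 0 < p.1 := hp.1.1
    by_cases hs : p.1 ∈ Iio t
    · rw [indicator_of_mem hs, norm_mul, mul_comm ‖φ p.1‖, ← mul_assoc]
      gcongr
      have h2 : t - p.1 ≤ T := by linarith [ht.2]
      refine (hb (t - p.1) (sub_pos.2 hs) h2 p.2 (.inr (hUρ _ hp.2))).trans ?_
      unfold gaussMajorant
      gcongr
    · rw [indicator_of_notMem hs, norm_zero]
      have := (gaussMajorant_pos (8 * d * T)⁻¹ p.2).le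
      positivity
  rw [e]
  refine (coeFn_integral_Lp
    (q := fun s x => (Iio t).indicator (fun s => heatKernel d (t - s) x * φ s) s)
    (P.integrable_comp hint) hq (.of_forall fun s => ?_)).trans
    (.of_forall fun x => ?_)
  · rw [map_smul]
    by_cases hs : s ∈ Iio t
    · have hts : 0 < t - s := sub_pos.2 hs
      rw [kernelCurve_of_pos hts, (isJet_jetKernel hd hts U).component_mkH2]
      filter_upwards [Lp.coeFn_smul (φ s) (lpOf (volume.restrict U)
          (jetKernel d (Sum.inl ()) (t - s))),
        coeFn_lpOf ((isJet_jetKernel hd hts U).memLp (Sum.inl ()))] with x h1 h2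
      rw [h1, Pi.smul_apply, h2, indicator_of_mem hs, smul_eq_mul, mul_comm]
      rfl
    · have hts : t - s ≤ 0 := sub_nonpos.2 (not_lt.1 hs)
      rw [kernelCurve_of_nonpos hts, map_zero, smul_zero]
      filter_upwards [Lp.coeFn_zero ℝ 2 (volume.restrict U)] with x h1
      rw [h1, indicator_of_notMem hs]
      rfl
  · simp only
    rw [setIntegral_indicator measurableSet_Iio, intervalIntegral.integral_of_le ht.1.le,
      integral_Ioc_eq_integral_Ioo]
    congr 2
    ext s
    exact ⟨fun h => ⟨h.1.1, h.2⟩, fun h => ⟨⟨h.1, h.2.trans_le ht.2⟩, h.2⟩⟩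

end Duhamel

/-! ### The mild solution on the exterior domain -/

theorem exteriorDomain_norm_sq_ge {O : Set Plane} (hO : IsOpen O) (h0 : (0 : Plane) ∈ O) :
    ∃ ρ : ℝ, 0 < ρ ∧ ∀ x ∈ exteriorDomain O, ρ ≤ ‖x‖ ^ 2 := by
  obtain ⟨r, hr, hball⟩ := Metric.isOpen_iff.1 hO 0 h0
  refine ⟨r ^ 2, by positivity, fun x hx => ?_⟩
  have : r ≤ ‖x‖ := by
    by_contra! h
    exact hx (subset_closure (hball (mem_ball_zero_iff.2 h)))
  gcongr

/-- On an interval the derivative in the unit direction determines those in all directions. -/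
theorem memH1_of_isWeakDeriv_one {F : Type*} [NormedAddCommGroup F] [NormedSpace ℝ F]
    [CompleteSpace F] {a b : ℝ} {u u' : ℝ → F} (hu : MemLp u 2 (volume.restrict (Ioo a b)))
    (hu' : MemLp u' 2 (volume.restrict (Ioo a b))) (h : IsWeakDeriv (Ioo a b) (1 : ℝ) u u') :
    MemH1 (Ioo a b) u := by
  refine ⟨hu, fun v => ⟨fun t => v • u' t, hu'.const_smul v, fun ψ hψ hs hU => ?_⟩⟩
  have e1 (t : ℝ) : fderiv ℝ ψ t v = v * fderiv ℝ ψ t 1 := by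
    rw [← smul_eq_mul, ← map_smul, smul_eq_mul, mul_one]
  simp only [e1, mul_smul, smul_comm (ψ _) v]
  rw [integral_smul, integral_smul, h ψ hψ hs hU, smul_neg]

end

theorem theorem5p2 (d T : ℝ) (hd : 0 < d) (hT : 0 < T)
    (O : Set Plane) (hO : IsOpen O) (hOb : Bornology.IsBounded O) (h0 : (0 : Plane) ∈ O)
    (u₀ : Plane → ℝ) (hu₀ : MemH1 Set.univ u₀)
    (φ : ℝ → ℝ) (hφ : MemH1 (Set.Ioo 0 T) φ) :
    -- the two integrals in the mild solution converge at every point of the exterior domain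
    (∀ t ∈ Set.Ioc 0 T, ∀ x ∈ exteriorDomain O,
      Integrable (fun y => heatKernel d t (x - y) * u₀ y) ∧
      IntervalIntegrable (fun s => heatKernel d (t - s) x * φ s) volume 0 t) ∧
    -- the restriction of the mild solution to the exterior domain, as an `L²`-valued function
    ∃ u : ℝ → L2Space (exteriorDomain O),
      (∀ t ∈ Set.Ioc 0 T,
        u t =ᵐ[volume.restrict (exteriorDomain O)] mildSolution d u₀ φ t) ∧
      MemH1 (Set.Ioo 0 T) u ∧
      ∃ w : ℝ → H2Space (exteriorDomain O),
        MemLp w 2 (volume.restrict (Set.Ioo 0 T)) ∧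
        (∀ᵐ t ∂volume.restrict (Set.Ioo 0 T), H2Space.toL2 (w t) = u t) ∧
        ∃ u' : ℝ → L2Space (exteriorDomain O),
          MemLp u' 2 (volume.restrict (Set.Ioo 0 T)) ∧
          IsWeakDeriv (Set.Ioo 0 T) 1 u u' ∧
          ∀ᵐ t ∂volume.restrict (Set.Ioo 0 T), u' t = d • H2Space.laplacian (w t) := by
  obtain ⟨ρ, hρ, hUρ⟩ := exteriorDomain_norm_sq_ge hO h0
  have hU : MeasurableSet (exteriorDomain O) := isClosed_closure.measurableSet.compl
  have m₀ : MemLp u₀ 2 := by simpa using hu₀.1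
  have hφ1 : IntegrableOn φ (Ioo 0 T) := hφ.1.integrable (by norm_num)
  refine ⟨fun t ht x hx => ⟨(jetKernel_gaussBounded hd ht.1 (Sum.inl ())).integrable_mul m₀ x,
    heatKernel_duhamel_intervalIntegrable hd hρ hT hφ1 ht (hUρ x hx)⟩, ?_⟩
  set U := exteriorDomain O
  set w : ℝ → H2Space U := fun t => heatFlow d u₀ U t + duhamel d T φ U t with hw
  set P := H2Space.component U (Sum.inl ()) with hP
  set L : H2Space U →L[ℝ] L2Space U := d • H2Space.laplacianCLM U with hL
  have hLw (v : H2Space U) : L v = d • H2Space.laplacian v := by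
    rw [hL, smul_apply, H2Space.laplacianCLM_apply]
  have mw : MemLp w 2 (volume.restrict (Ioo 0 T)) :=
    (heatFlow_memLp hd hT hu₀ U).add (duhamel_memLp hd hρ hU hUρ hT hφ1)
  have cw : ContinuousOn w (Ioo 0 T) :=
    ((heatFlow_continuousOn hd m₀ U).mono Ioo_subset_Ioi_self).add
      ((duhamel_continuousOn hd hρ hU hUρ hT hφ1).1.mono fun t ht => ht.2.le)
  have dw : ∀ t ∈ Ioo 0 T, HasDerivAt (fun t => P (w t)) (L (w t)) t := by
    intro t ht
    have h1 := heatFlow_hasDerivAt hd m₀ U ht.1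
    have h2 := duhamel_hasDerivAt hd hρ hU hUρ hT hφ1 ht
    rw [← hLw] at h1 h2
    rw [hw, map_add]
    refine (h1.add h2).congr_of_eventuallyEq (.of_forall fun s => ?_)
    exact map_add P _ _
  have mL : MemLp (fun t => L (w t)) 2 (volume.restrict (Ioo 0 T)) := L.comp_memLp' mw
  have hweak : IsWeakDeriv (Ioo 0 T) (1 : ℝ) (fun t => P (w t)) (fun t => L (w t)) :=
    isWeakDeriv_of_hasDerivAt dw (L.continuous.comp_continuousOn cw)
  refine ⟨fun t => P (w t), fun t ht => ?_,
    memH1_of_isWeakDeriv_one (P.comp_memLp' mw) mL hweak, w, mw, .of_forall fun t => rfl,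
    fun t => L (w t), mL, hweak, .of_forall fun t => hLw _⟩
  have e1 : P (heatFlow d u₀ U t) = lpOf (volume.restrict U) (gconv (heatKernel d t) u₀) :=
    (isJet_gconv hd ht.1 m₀ U).toL2_mkH2
  simp only [hw, map_add, e1]
  filter_upwards [Lp.coeFn_add (lpOf (volume.restrict U) (gconv (heatKernel d t) u₀))
    (P (duhamel d T φ U t)), coeFn_lpOf ((isJet_gconv hd ht.1 m₀ U).memLp (Sum.inl ())),
    coeFn_duhamel hd hρ hU hUρ hT hφ1 ht] with x h1 h2 h3
  rw [h1, Pi.add_apply]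
  exact congrArg₂ (· + ·) h2 h3
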